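/- Let $I$ be a nonempty countable totally ordered index set (for instance $\mathbb N$ or $\mathbb Z$), let $(E_k)_{k\in I}$ be an increasing system of Fréchet spaces over $\mathbb K\in\{\mathbb R,\mathbb C\}$ with compatible continuous linear injective linking maps $E_k\hookrightarrow E_l$ ($k\le l$), so that $\operatorname{ind\,lim}_k E_k$ is an LF-space, and let $F$ be a Fréchet space over $\mathbb K$. Here an inductive limit carries the finest locally convex topology for which the canonical maps from the steps are continuous; $E\otimes_\iota F$ is $E\otimes F$ with the finest locally convex topology for which the canonical map $E\times F\to E\otimes F$ is separately continuous; and $E\,\widehat\otimes_\iota F$ is the (Hausdorff) completion of $E\otimes_\iota F$. Suppose that the inductive limit $\operatorname{ind\,lim}_k (E_k\,\widehat\otimes_\iota F)$, formed with the continuous extensions of the maps $E_k\otimes F\to E_l\otimes F$ as linking maps, is compactly regular, i.e. each compact subset of the limit is contained in a step and compact there, in the sense that it is the canonical image of a compact subset of some step $E_k\,\widehat\otimes_\iota F$. Then $$\operatorname{ind\,lim}_k (E_k\,\widehat\otimes_\iota F) = (\operatorname{ind\,lim}_k E_k)\,\widehat\otimes_\iota F ,$$ that is, there is a linear homeomorphism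 from the left-hand side onto the right-hand side which, for all $k\in I$, $x\in E_k$, $y\in F$, sends the class of $x\otimes y\in E_k\,\widehat\otimes_\iota F$ to $x\otimes y$, where on the right $x$ is regarded as an element of $\operatorname{ind\,lim}_k E_k$. -/

import Mathlib

open scoped TensorProduct Topology
open UniformSpace

noncomputable section

/-- A Fréchet space over `𝕜 = ℝ` or `ℂ`: a complete metrizable locally convex topological vector
space. Over `ℝ` and `ℂ`, `PolynormableSpace` says that the topology is generated by seminorms, i.e.
that it is a locally convex vector space topology. -/
class IsFrechetSpace (𝕜 E : Type*) [RCLike 𝕜] [AddCommGroup E] [Module 𝕜 E] [UniformSpace E] :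
    Prop where
  isUniformAddGroup : IsUniformAddGroup E
  locallyConvex : PolynormableSpace 𝕜 E
  metrizable : TopologicalSpace.MetrizableSpace E
  complete : CompleteSpace E

/-! ### Locally convex inductive limits -/

section Limit

variable {𝕜 : Type*} [RCLike 𝕜] {ι : Type*} [LinearOrder ι] {G : ι → Type*}
  [∀ k, AddCommGroup (G k)] [∀ k, Module 𝕜 (G k)] [∀ k, TopologicalSpace (G k)]

/-- The inductive limit `ind lim G k` of a system of topological vector spaces with continuous
linear linking maps `f k l : G k → G l` for `k ≤ l`; as a vector space it is the algebraic
direct limit. -/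
def LCLimit (f : ∀ k l, k ≤ l → G k →L[𝕜] G l) : Type _ :=
  Module.DirectLimit G fun k l h => (f k l h : G k →ₗ[𝕜] G l)

namespace LCLimit

variable (f : ∀ k l, k ≤ l → G k →L[𝕜] G l)

instance : AddCommGroup (LCLimit f) :=
  inferInstanceAs (AddCommGroup (Module.DirectLimit G fun k l h => (f k l h : G k →ₗ[𝕜] G l)))

instance : Module 𝕜 (LCLimit f) :=
  inferInstanceAs (Module 𝕜 (Module.DirectLimit G fun k l h => (f k l h : G k →ₗ[𝕜] G l)))

/-- The canonical linear map from a step to the limit. -/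
def ofLinear (k : ι) : G k →ₗ[𝕜] LCLimit f :=
  Module.DirectLimit.of 𝕜 ι G (fun k l h => (f k l h : G k →ₗ[𝕜] G l)) k

/-- The finest locally convex topology for which all canonical maps `G k → ind lim G k` are
continuous. (In Mathlib's order on topologies, finer means smaller.) -/
instance : TopologicalSpace (LCLimit f) :=
  sInf {t | PolynormableSpace 𝕜 (LCLimit f) (topology := t) ∧
    ∀ k, Continuous[inferInstance, t] (ofLinear f k)}

instance : PolynormableSpace 𝕜 (LCLimit f) := .sInf fun _ ht => ht.1

/-- The canonical map from a step to the limit. -/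
def of (k : ι) : G k →L[𝕜] LCLimit f :=
  ⟨ofLinear f k, continuous_sInf_rng.2 fun _ ht => ht.2 k⟩

end LCLimit

/-- The inductive limit of the system is compactly regular: each compact subset of the limit is
contained in a step and compact there, i.e. it is (the canonical image of) a compact subset of
some step. -/
def IsCompactlyRegular (f : ∀ k l, k ≤ l → G k →L[𝕜] G l) : Prop :=
  ∀ K : Set (LCLimit f), IsCompact K →
    ∃ (k : ι) (C : Set (G k)), IsCompact C ∧ LCLimit.of f k '' C = K

end Limit

/-- The system `f` presents an LF-space `ind lim E k`: the steps `E k` are Fréchet spaces, and the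
linking maps (the inclusions `E k ⊆ E l`, `k ≤ l`) are compatible, continuous, linear and
injective. -/
structure IsLFSystem {𝕜 : Type*} [RCLike 𝕜] {ι : Type*} [LinearOrder ι] {E : ι → Type*}
    [∀ k, AddCommGroup (E k)] [∀ k, Module 𝕜 (E k)] [∀ k, UniformSpace (E k)]
    (f : ∀ k l, k ≤ l → E k →L[𝕜] E l) : Prop where
  isFrechetSpace : ∀ k, IsFrechetSpace 𝕜 (E k)
  map_self : ∀ (k : ι) (x : E k), f k k le_rfl x = x
  map_map : ∀ (k l m : ι) (hkl : k ≤ l) (hlm : l ≤ m) (x : E k),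
    f l m hlm (f k l hkl x) = f k m (hkl.trans hlm) x
  injective : ∀ (k l : ι) (h : k ≤ l), Function.Injective (f k l h)

/-! ### The inductive tensor product and its completion -/

/-- The tensor product `E ⊗ F` with the inductive topology, `E ⊗_ι F`. -/
def InductiveTensor (𝕜 E F : Type*) [RCLike 𝕜] [AddCommGroup E] [Module 𝕜 E] [AddCommGroup F]
    [Module 𝕜 F] : Type _ :=
  E ⊗[𝕜] F

namespace InductiveTensor

section Basic

variable (𝕜 E F : Type*) [RCLike 𝕜] [AddCommGroup E] [Module 𝕜 E] [AddCommGroup F] [Module 𝕜 F]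

instance : AddCommGroup (InductiveTensor 𝕜 E F) := inferInstanceAs (AddCommGroup (E ⊗[𝕜] F))

instance : Module 𝕜 (InductiveTensor 𝕜 E F) := inferInstanceAs (Module 𝕜 (E ⊗[𝕜] F))

variable {E F}

/-- The elementary tensor `x ⊗ y`. -/
def tmul (x : E) (y : F) : InductiveTensor 𝕜 E F := x ⊗ₜ[𝕜] y

variable (E F) [TopologicalSpace E] [TopologicalSpace F]

/-- The inductive topology: the finest locally convex topology for which the canonical map
`E × F → E ⊗ F` is partially (i.e. separately) continuous. -/
instance : TopologicalSpace (InductiveTensor 𝕜 E F) :=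
  sInf {t | PolynormableSpace 𝕜 (InductiveTensor 𝕜 E F) (topology := t) ∧
    (∀ x : E, Continuous[inferInstance, t] fun y : F => tmul 𝕜 x y) ∧
    (∀ y : F, Continuous[inferInstance, t] fun x : E => tmul 𝕜 x y)}

instance : PolynormableSpace 𝕜 (InductiveTensor 𝕜 E F) := .sInf fun _ ht => ht.1

instance : IsTopologicalAddGroup (InductiveTensor 𝕜 E F) :=
  (PolynormableSpace.withSeminorms 𝕜 _).topologicalAddGroup

instance : ContinuousSMul 𝕜 (InductiveTensor 𝕜 E F) :=
  (PolynormableSpace.withSeminorms 𝕜 _).continuousSMul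

instance : UniformSpace (InductiveTensor 𝕜 E F) :=
  IsTopologicalAddGroup.rightUniformSpace _

instance : IsUniformAddGroup (InductiveTensor 𝕜 E F) :=
  isUniformAddGroup_of_addCommGroup

instance : UniformContinuousConstSMul 𝕜 (InductiveTensor 𝕜 E F) :=
  uniformContinuousConstSMul_of_continuousConstSMul _ _

end Basic

variable {𝕜 E E' : Type*} (F : Type*) [RCLike 𝕜] [AddCommGroup E] [Module 𝕜 E]
  [AddCommGroup E'] [Module 𝕜 E'] [AddCommGroup F] [Module 𝕜 F]
  [TopologicalSpace E] [TopologicalSpace E'] [TopologicalSpace F]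

/-- The continuous linear map `g ⊗ id : E ⊗_ι F → E' ⊗_ι F`. -/
def map (g : E →L[𝕜] E') : InductiveTensor 𝕜 E F →L[𝕜] InductiveTensor 𝕜 E' F where
  toLinearMap := LinearMap.rTensor F (g : E →ₗ[𝕜] E')
  cont := by
    refine continuous_sInf_rng.2 fun t ht => ?_
    rw [continuous_iff_le_induced]
    refine sInf_le ⟨?_, fun x => ?_, fun y => ?_⟩
    · exact @PolynormableSpace.induced _ _ _ _ _ _ _ _ _ _ _ _ t ht.1 _
    · exact continuous_induced_rng.2 (ht.2.1 (g x))
    · have h : Continuous[inferInstance, t] fun x : E' => tmul 𝕜 x y := ht.2.2 y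
      exact continuous_induced_rng.2 (h.comp g.continuous)

end InductiveTensor

/-- The completed inductive tensor product: the (Hausdorff) completion of `E ⊗_ι F`. -/
abbrev CompletedTensor (𝕜 E F : Type*) [RCLike 𝕜] [AddCommGroup E] [Module 𝕜 E]
    [AddCommGroup F] [Module 𝕜 F] [TopologicalSpace E] [TopologicalSpace F] : Type _ :=
  Completion (InductiveTensor 𝕜 E F)

namespace CompletedTensor

variable (𝕜 : Type*) {E E' : Type*} (F : Type*) [RCLike 𝕜] [AddCommGroup E] [Module 𝕜 E]
  [AddCommGroup E'] [Module 𝕜 E'] [AddCommGroup F] [Module 𝕜 F]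
  [TopologicalSpace E] [TopologicalSpace E'] [TopologicalSpace F]

variable {F} in
/-- The elementary tensor `x ⊗ y` in the completed tensor product. -/
def tmul (x : E) (y : F) : CompletedTensor 𝕜 E F :=
  (InductiveTensor.tmul 𝕜 x y : InductiveTensor 𝕜 E F)

variable {𝕜} in
/-- The continuous linear extension of `g ⊗ id` to the completions. -/
def map (g : E →L[𝕜] E') : CompletedTensor 𝕜 E F →L[𝕜] CompletedTensor 𝕜 E' F :=
  (InductiveTensor.map F g).completion

end CompletedTensor

/-- The linking maps of the system `E k ⊗̂_ι F` obtained from those of the system `E k`. -/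
def tensorSystem {𝕜 : Type*} [RCLike 𝕜] {ι : Type*} [LinearOrder ι] {E : ι → Type*}
    [∀ k, AddCommGroup (E k)] [∀ k, Module 𝕜 (E k)] [∀ k, TopologicalSpace (E k)]
    (f : ∀ k l, k ≤ l → E k →L[𝕜] E l)
    (F : Type*) [AddCommGroup F] [Module 𝕜 F] [TopologicalSpace F] :
    ∀ k l, k ≤ l → CompletedTensor 𝕜 (E k) F →L[𝕜] CompletedTensor 𝕜 (E l) F :=
  fun k l h => CompletedTensor.map F (f k l h)

end

/-! Write G k for the completed tensor product of E k and F. Universal properties provide continuous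
maps in both directions. The maps G k → (ind lim E k) ⊗̂ F glue to `tensorLimitMap`, and x ⊗ y, with
x taken in a step, induces `limitTensorLinear` from the uncompleted tensor product to ind lim G k.
The latter extends to the completion as soon as ind lim G k is complete and Hausdorff. The two maps
are then mutually inverse, because this can be tested on elementary tensors, whose span is dense. So
the theorem reduces to this: a compactly regular countable inductive limit of Fréchet spaces is
Hausdorff and complete.

The steps G k are Fréchet spaces: by Banach–Steinhaus every continuous seminorm on E k ⊗_ι F is
dominated by a product of continuous seminorms (`InductiveTensor.exists_le_mul`), so countably many
seminorms suffice. Their linking maps are not known to be injective, so kernels must be controlled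
as well.

Hausdorff (`t2Space_of_isCompactlyRegular`): inside the closure of 0 every set is compact, however
wild; the irrational multiples of a nonzero vector contradict Baire's theorem. Baire also makes the
kernels of the linking maps out of G k stabilise (`exists_ker_le`).

Acyclicity (`exists_acyclic_step`): if on no neighbourhood of zero in G k the topologies of later
steps agreed from some index on, a diagonal construction would give a family tending to 0 in the
limit whose range, with 0 added, is compact but does not come from a compact subset of any step.

Completeness (`IsSeqLimit.exists_limit`): acyclicity first gives that on a ball of X n the limit
topology is at least as fine as that of X (n + 1) (`exists_seminorm_lt`). This yields increasing
disks A n whose small elements lift to small elements of X (n + 1) (`exists_disks`). A Cauchy filter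
comes arbitrarily close to a multiple of one A n (`exists_trace`), so it can be approximated by a
Cauchy sequence in the Fréchet space X (n + 1), whose limit is the limit of the filter. -/

noncomputable section

/-! ### Continuous seminorms in locally convex spaces -/

section Seminorms

variable {𝕜 X : Type*} [RCLike 𝕜] [AddCommGroup X] [Module 𝕜 X]

theorem Seminorm.le_of_lt_one_imp {p q : Seminorm 𝕜 X} (h : ∀ x, q x < 1 → p x < 1) : p ≤ q := by
  intro x
  by_contra! hx
  obtain ⟨t, ht1, ht2⟩ := exists_between hx
  have ht : 0 < t := (apply_nonneg q x).trans_lt ht1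
  have hn : ‖((t : 𝕜))⁻¹‖ = t⁻¹ := by simp [abs_of_pos ht]
  have h1 := h ((t : 𝕜)⁻¹ • x) (by
    rw [map_smul_eq_mul, hn, inv_mul_lt_iff₀ ht]; linarith)
  rw [map_smul_eq_mul, hn, inv_mul_lt_iff₀ ht] at h1
  linarith

theorem Seminorm.exists_continuous_const_mul [TopologicalSpace X] {p : Seminorm 𝕜 X}
    (hp : Continuous p) {c : ℝ} (hc : 0 ≤ c) :
    ∃ q : Seminorm 𝕜 X, Continuous q ∧ ∀ x, q x = c * p x := by
  lift c to NNReal using hc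
  exact ⟨c • p, hp.const_smul c, fun x => rfl⟩

theorem Seminorm.continuous_add [TopologicalSpace X] {p q : Seminorm 𝕜 X}
    (hp : Continuous p) (hq : Continuous q) : Continuous (p + q : Seminorm 𝕜 X) :=
  Continuous.add hp hq

theorem PolynormableSpace.exists_seminorm_lt_one_subset (𝕜) [RCLike 𝕜] [Module 𝕜 X]
    [TopologicalSpace X] [PolynormableSpace 𝕜 X]
    {V : Set X} (hV : V ∈ 𝓝 (0 : X)) :
    ∃ p : Seminorm 𝕜 X, Continuous p ∧ ∀ x, p x < 1 → x ∈ V := by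
  have := (PolynormableSpace.withSeminorms 𝕜 X).topologicalAddGroup
  obtain ⟨s, r, hr, h⟩ := ((PolynormableSpace.withSeminorms 𝕜 X).mem_nhds_iff 0 V).1 hV
  have hc : Continuous ⇑(s.sup fun p : {p : Seminorm 𝕜 X // Continuous p} => (p.1 : Seminorm 𝕜 X)) :=
    Seminorm.continuous_finsetSup fun i _ => i.2
  obtain ⟨q, hq, hq'⟩ := Seminorm.exists_continuous_const_mul hc (inv_nonneg.2 hr.le)
  refine ⟨q, hq, fun x hx => h ?_⟩
  rw [hq', inv_mul_lt_iff₀ hr, mul_one] at hx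
  simpa [Seminorm.mem_ball] using hx

theorem Seminorm.lt_one_mem_nhds [TopologicalSpace X] {p : Seminorm 𝕜 X} (hp : Continuous p) :
    {x | p x < 1} ∈ 𝓝 (0 : X) :=
  (isOpen_lt hp continuous_const).mem_nhds (by simp)

theorem PolynormableSpace.of_exists_seminorm [TopologicalSpace X] [IsTopologicalAddGroup X]
    (h : ∀ V ∈ 𝓝 (0 : X), ∃ p : Seminorm 𝕜 X, Continuous p ∧ ∀ x, p x < 1 → x ∈ V) :
    PolynormableSpace 𝕜 X where
  withSeminorms' := by
    rw [SeminormFamily.withSeminorms_iff_nhds_eq_iInf]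
    refine le_antisymm ?_ ?_
    · simp_rw [le_iInf_iff, ← Filter.tendsto_iff_comap]
      intro p
      simpa using p.2.tendsto 0
    · intro V hV
      obtain ⟨p, hp, hpV⟩ := h V hV
      refine Filter.mem_iInf_of_mem (ι := {p : Seminorm 𝕜 X // Continuous p}) ⟨p, hp⟩ ?_
      refine ⟨Set.Iio 1, Iio_mem_nhds one_pos, fun x hx => hpV x hx⟩

theorem continuous_of_seminorm {𝕜 Y : Type*} [RCLike 𝕜] [Module 𝕜 X] [AddCommGroup Y] [Module 𝕜 Y]
    [TopologicalSpace X] [IsTopologicalAddGroup X] [TopologicalSpace Y] [PolynormableSpace 𝕜 Y]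
    (f : X →ₗ[𝕜] Y) (h : ∀ p : Seminorm 𝕜 Y, Continuous p → Continuous (p.comp f)) :
    Continuous f := by
  have := (PolynormableSpace.withSeminorms 𝕜 Y).topologicalAddGroup
  refine continuous_of_continuousAt_zero f ?_
  rw [ContinuousAt, map_zero]
  intro V hV
  obtain ⟨p, hp, hpV⟩ := PolynormableSpace.exists_seminorm_lt_one_subset 𝕜 hV
  exact Filter.mem_of_superset (Seminorm.lt_one_mem_nhds (h p hp)) fun x hx => hpV _ hx

theorem Seminorm.exists_monotone_le [TopologicalSpace X] (s : ℕ → Seminorm 𝕜 X)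
    (hs : ∀ n, Continuous (s n)) :
    ∃ r : ℕ → Seminorm 𝕜 X, Monotone r ∧ (∀ n, Continuous (r n)) ∧ ∀ n, s n ≤ r n := by
  let r : ℕ → Seminorm 𝕜 X := fun n => Nat.rec (s 0) (fun k q => q + s (k + 1)) n
  have hr : ∀ n, r (n + 1) = r n + s (n + 1) := fun n => rfl
  refine ⟨r, monotone_nat_of_le_succ fun n x => ?_, fun n => ?_, fun n x => ?_⟩
  · rw [hr]
    exact le_add_of_nonneg_right (apply_nonneg (s (n + 1)) x)
  · induction n with
    | zero => exact hs 0
    | succ n ih => exact Seminorm.continuous_add ih (hs _)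
  · cases n with
    | zero => exact le_rfl
    | succ n => exact le_add_of_nonneg_left (apply_nonneg (r n) x)

/-- A first countable locally convex space has an increasing cofinal sequence of continuous
seminorms. -/
theorem PolynormableSpace.exists_seq_seminorm (𝕜 X : Type*) [RCLike 𝕜] [AddCommGroup X]
    [Module 𝕜 X] [TopologicalSpace X] [FirstCountableTopology X] [PolynormableSpace 𝕜 X] :
    ∃ r : ℕ → Seminorm 𝕜 X, Monotone r ∧ (∀ n, Continuous (r n)) ∧
      ∀ p : Seminorm 𝕜 X, Continuous p → ∃ n, p ≤ r n := by
  obtain ⟨V, hV⟩ := (𝓝 (0 : X)).exists_antitone_basis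
  choose s hs hsV using fun n =>
    PolynormableSpace.exists_seminorm_lt_one_subset 𝕜 (hV.1.mem_of_mem (i := n) trivial)
  obtain ⟨r, hrm, hrc, hsr⟩ := Seminorm.exists_monotone_le s hs
  refine ⟨r, hrm, hrc, fun p hp => ?_⟩
  obtain ⟨n, -, hn⟩ := hV.1.mem_iff.1 (Seminorm.lt_one_mem_nhds hp)
  exact ⟨n, Seminorm.le_of_lt_one_imp fun x hx => hn (hsV n x ((hsr n x).trans_lt hx))⟩

end Seminorms

/-! ### Finite sums of steps and seminorms on a sequential limit -/

/-- The initial segment `d 0, …, d (N - 1)` of `d`, extended by zero. -/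
def truncSeq {X : ℕ → Type*} [∀ n, Zero (X n)] (N : ℕ) (d : ∀ n, X n) : ∀ n, X n :=
  fun n => if n < N then d n else 0

theorem truncSeq_of_le {X : ℕ → Type*} [∀ n, Zero (X n)] {N n : ℕ} (d : ∀ n, X n) (h : N ≤ n) :
    truncSeq N d n = 0 := if_neg h.not_gt

theorem sum_truncSeq {X : ℕ → Type*} [∀ n, Zero (X n)] {A : Type*} [AddCommMonoid A]
    (f : ∀ n, X n → A) (hf : ∀ n, f n 0 = 0) {N M : ℕ} (h : N ≤ M) (d : ∀ n, X n) :
    ∑ i ∈ Finset.range M, f i (truncSeq N d i) = ∑ i ∈ Finset.range N, f i (d i) := by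
  rw [← Finset.sum_subset (Finset.range_mono h)]
  · refine Finset.sum_congr rfl fun i hi => ?_
    rw [truncSeq, if_pos (Finset.mem_range.1 hi)]
  · intro i _ hi
    rw [truncSeq_of_le d (by simpa using hi), hf]

theorem sum_pi_single_apply {X : ℕ → Type*} [∀ n, AddCommGroup (X n)] {A : Type*} [AddCommMonoid A] (f : ∀ n, X n → A)
    (hf : ∀ n, f n 0 = 0) (n : ℕ) (x : X n) :
    ∑ i ∈ Finset.range (n + 1), f i ((Pi.single n x : ∀ i, X i) i) = f n x := by
  rw [Finset.sum_eq_single n]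
  · simp
  · intro i _ hi
    rw [Pi.single_eq_of_ne hi, hf]
  · simp

section SeqLimit

variable {𝕜 : Type*} [RCLike 𝕜] {X : ℕ → Type*} [∀ n, AddCommGroup (X n)] [∀ n, Module 𝕜 (X n)]
  [∀ n, TopologicalSpace (X n)] {E : Type*} [AddCommGroup E] [Module 𝕜 E] [TopologicalSpace E]

/-- `E` is the locally convex inductive limit of the sequence `X n` with linking maps `u` and
canonical maps `j`. -/
structure IsSeqLimit (u : ∀ m n, m ≤ n → X m →L[𝕜] X n) (j : ∀ n, X n →L[𝕜] E) : Prop where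
  map_self : ∀ n x, u n n le_rfl x = x
  map_map : ∀ l m n (hlm : l ≤ m) (hmn : m ≤ n) x, u m n hmn (u l m hlm x) = u l n (hlm.trans hmn) x
  apply_map : ∀ m n (h : m ≤ n) x, j n (u m n h x) = j m x
  exists_eq : ∀ y, ∃ n x, j n x = y
  exists_map_eq_zero : ∀ n x, j n x = 0 → ∃ m, ∃ h : n ≤ m, u n m h x = 0
  seminorm_continuous : ∀ P : Seminorm 𝕜 E,
    (∀ n, Continuous (P.comp (j n : X n →ₗ[𝕜] E))) → Continuous P

variable {u : ∀ m n, m ≤ n → X m →L[𝕜] X n} {j : ∀ n, X n →L[𝕜] E}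

/-- The limit is a quotient of the direct sum of the steps. The seminorm is the quotient of the
ℓ¹-sum of the C n, that is, the infimum of ∑ C i (d i) over all representations y = ∑ j i (d i). -/
theorem IsSeqLimit.exists_seminorm [∀ n, PolynormableSpace 𝕜 (X n)] (H : IsSeqLimit u j) (C : ∀ n, Seminorm 𝕜 (X n))
    (hC : ∀ n, Continuous (C n)) :
    ∃ P : Seminorm 𝕜 E, Continuous P ∧ ∀ y, P y < 1 → ∃ (N : ℕ) (d : ∀ n, X n),
      y = ∑ i ∈ Finset.range N, j i (d i) ∧ ∑ i ∈ Finset.range N, C i (d i) < 1 := by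
  let S : E → Set ℝ := fun y => {c | ∃ (N : ℕ) (d : ∀ n, X n),
      y = ∑ i ∈ Finset.range N, j i (d i) ∧ ∑ i ∈ Finset.range N, C i (d i) = c}
  have hSj : ∀ n x, C n x ∈ S (j n x) := fun n x =>
    ⟨n + 1, Pi.single n x, (sum_pi_single_apply (fun i => j i) (fun i => map_zero _) n x).symm,
      sum_pi_single_apply (fun i => C i) (fun i => map_zero _) n x⟩
  have hne : ∀ y, (S y).Nonempty := fun y => by
    obtain ⟨n, x, rfl⟩ := H.exists_eq y
    exact ⟨_, hSj n x⟩
  have h0 : ∀ y, ∀ c ∈ S y, 0 ≤ c := by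
    rintro y c ⟨N, d, -, rfl⟩
    exact Finset.sum_nonneg fun i _ => apply_nonneg _ _
  have hbdd : ∀ y, BddBelow (S y) := fun y => ⟨0, h0 y⟩
  let P : Seminorm 𝕜 E := Seminorm.ofSMulLE (fun y => sInf (S y))
    (le_antisymm (csInf_le (hbdd 0) ⟨0, 0, by simp⟩) (le_csInf (hne 0) (h0 0)))
    (by
      intro x y
      refine le_of_forall_pos_le_add fun ε hε => ?_
      obtain ⟨c, ⟨N, d, hx, rfl⟩, hc⟩ := exists_lt_of_csInf_lt (hne x)
        (lt_add_of_pos_right (sInf (S x)) (half_pos hε))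
      obtain ⟨c', ⟨M, e, hy, rfl⟩, hc'⟩ := exists_lt_of_csInf_lt (hne y)
        (lt_add_of_pos_right (sInf (S y)) (half_pos hε))
      have h1 := sum_truncSeq (fun i => j i) (fun i => map_zero _) (le_max_left N M) d
      have h2 := sum_truncSeq (fun i => j i) (fun i => map_zero _) (le_max_right N M) e
      have h3 := sum_truncSeq (fun i => C i) (fun i => map_zero _) (le_max_left N M) d
      have h4 := sum_truncSeq (fun i => C i) (fun i => map_zero _) (le_max_right N M) e
      have h5 : ∑ i ∈ Finset.range (max N M), C i (truncSeq N d i + truncSeq M e i) ∈ S (x + y) := by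
        refine ⟨max N M, fun i => truncSeq N d i + truncSeq M e i, ?_, rfl⟩
        simp only [map_add, Finset.sum_add_distrib]
        rw [hx, hy, ← h1, ← h2]
      refine (csInf_le (hbdd _) h5).trans ?_
      have h6 : ∑ i ∈ Finset.range (max N M), C i (truncSeq N d i + truncSeq M e i) ≤
          ∑ i ∈ Finset.range (max N M), (C i (truncSeq N d i) + C i (truncSeq M e i)) :=
        Finset.sum_le_sum fun i _ => map_add_le_add _ _ _
      rw [Finset.sum_add_distrib, h3, h4] at h6
      linarith)
    (by
      intro a x
      refine le_of_forall_pos_le_add fun ε hε => ?_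
      obtain ⟨c, ⟨N, d, hx, rfl⟩, hc⟩ := exists_lt_of_csInf_lt (hne x)
        -- The summand 1 in the denominator covers a = 0.
        (lt_add_of_pos_right (sInf (S x)) (div_pos hε (show 0 < ‖a‖ + 1 by positivity)))
      have h5 : ‖a‖ * ∑ i ∈ Finset.range N, C i (d i) ∈ S (a • x) := by
        refine ⟨N, fun i => a • d i, ?_, ?_⟩
        · rw [hx, Finset.smul_sum]
          simp
        · rw [Finset.mul_sum]
          simp [map_smul_eq_mul]
      refine (csInf_le (hbdd _) h5).trans ?_
      have h6 : ‖a‖ * (ε / (‖a‖ + 1)) ≤ ε := by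
        rw [mul_div_assoc', div_le_iff₀ (by positivity)]
        nlinarith [norm_nonneg a]
      nlinarith [norm_nonneg a])
  refine ⟨P, H.seminorm_continuous P fun n => ?_, fun y hy => ?_⟩
  · have := (PolynormableSpace.withSeminorms 𝕜 (X n)).topologicalAddGroup
    have := (PolynormableSpace.withSeminorms 𝕜 (X n)).continuousSMul
    refine Seminorm.continuous_of_le (hC n) fun x => ?_
    exact csInf_le (hbdd _) (hSj n x)
  · obtain ⟨c, ⟨N, d, hx, rfl⟩, hc⟩ := exists_lt_of_csInf_lt (hne y) hy
    exact ⟨N, d, hx, hc⟩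

/-! ### Acyclic sequences -/

/-- A quantitative form of acyclicity: on the unit ball of `p n`, the topologies of `X (n + 1)` and
`X k` agree for `k ≥ n + 1`. -/
def IsAcyclicSeq (u : ∀ m n, m ≤ n → X m →L[𝕜] X n) (p : ∀ n, Seminorm 𝕜 (X n)) : Prop :=
  (∀ n, Continuous (p n)) ∧ ∀ n, ∀ r : Seminorm 𝕜 (X (n + 1)), Continuous r → ∀ ε : ℝ, 0 < ε →
    ∃ q : Seminorm 𝕜 (X (n + 2)), Continuous q ∧ ∀ x : X n,
      r (u n (n + 1) (Nat.le_succ n) x) ≤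
        ε * p n x + q (u n (n + 2) (Nat.le_add_right n 2) x)

/-- Let B be the maximum of b, attained at m. Every P k is at most B + 2, so summing the geometric
errors up to the point where b vanishes gives b k ≤ c (B + 4) / 2^(k+1). At k = m this reads B ≤ c
(B + 4) / 2, and c ≤ 1 yields B ≤ 4c. -/
theorem le_four_mul_of_chain (b P : ℕ → ℝ) (c : ℝ) (hc0 : 0 ≤ c) (hc1 : c ≤ 1)
    (hb : ∀ k, 0 ≤ b k) (hP0 : P 0 ≤ 2) (hP : ∀ k, P (k + 1) ≤ b k + 2)
    (h : ∀ k, b k ≤ c * (1 / 2) ^ (k + 2) * P k + c * (1 / 2) ^ (k + 1) + b (k + 1))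
    (hN : ∃ N, ∀ k, N ≤ k → b k = 0) : b 0 ≤ 4 * c := by
  obtain ⟨N, hN⟩ := hN
  obtain ⟨m, -, hm⟩ := Finset.exists_max_image (Finset.range (N + 1)) b ⟨0, by simp⟩
  have hm : ∀ k, b k ≤ b m := fun k => by
    rcases lt_or_ge k (N + 1) with hk | hk
    · exact hm k (Finset.mem_range.2 hk)
    · rw [hN k (by omega)]
      exact hb m
  have hPt : ∀ k, P k ≤ b m + 2 := fun k => by
    cases k with
    | zero => linarith [hb m]
    | succ k => linarith [hP k, hm k]
  -- Induction on the distance i from the range where b vanishes.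
  have key : ∀ i k, N ≤ k + i → b k ≤ c * (b m + 4) * (1 / 2) ^ (k + 1) := by
    intro i
    induction i with
    | zero =>
      intro k hk
      rw [hN k hk]
      have := hb m
      positivity
    | succ i ih =>
      intro k hk
      have h1 := ih (k + 1) (by omega)
      have h2 := h k
      have h3 : c * (1 / 2) ^ (k + 2) * P k ≤ c * (1 / 2) ^ (k + 2) * (b m + 2) :=
        mul_le_mul_of_nonneg_left (hPt k) (by positivity)
      have h4 : c * (b m + 4) * (1 / 2) ^ (k + 1) =
          c * (1 / 2) ^ (k + 2) * (b m + 2) + c * (1 / 2) ^ (k + 1)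
          + c * (b m + 4) * (1 / 2) ^ (k + 1 + 1) := by ring
      linarith
  have h1 := key N m (by omega)
  have h2 : c * (b m + 4) * (1 / 2) ^ (m + 1) ≤ c * (b m + 4) * (1 / 2) := by
    refine mul_le_mul_of_nonneg_left ?_ (by have := hb m; positivity)
    rw [pow_succ]
    have : ((1 : ℝ) / 2) ^ m ≤ 1 := pow_le_one₀ (by norm_num) (by norm_num)
    linarith
  have h3 := hm 0
  nlinarith [hb m]

end SeqLimit

section SeqLimit

variable {𝕜 : Type*} [RCLike 𝕜] {X : ℕ → Type*} [∀ n, AddCommGroup (X n)] [∀ n, Module 𝕜 (X n)]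
  [∀ n, TopologicalSpace (X n)] {E : Type*} [AddCommGroup E] [Module 𝕜 E] [TopologicalSpace E]
  {u : ∀ m n, m ≤ n → X m →L[𝕜] X n} {j : ∀ n, X n →L[𝕜] E} {p : ∀ n, Seminorm 𝕜 (X n)}

/-- Acyclicity is iterated with geometrically decreasing errors: ρ 0 = r + p (n + 1), and ρ (k + 1)
is the seminorm q supplied for ρ k plus p (n + k + 2). The added p keeps the next error term under
control. -/
theorem IsAcyclicSeq.exists_chain (hp : IsAcyclicSeq u p) (n : ℕ)
    {r : Seminorm 𝕜 (X (n + 1))} (hr : Continuous r) {c : ℝ} (hc : 0 < c) :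
    ∃ ρ : ∀ k, Seminorm 𝕜 (X (n + k + 1)), (∀ k, Continuous (ρ k)) ∧ (∀ x, r x ≤ ρ 0 x) ∧
      (∀ k x, p (n + k + 1) x ≤ ρ k x) ∧
      ∀ (k : ℕ) (x : X (n + k)), ρ k (u (n + k) (n + k + 1) (Nat.le_succ _) x) ≤
        c * (1 / 2) ^ (k + 2) * p (n + k) x +
          ρ (k + 1) (u (n + k) (n + k + 2) (Nat.le_add_right _ 2) x) := by
  have hε : ∀ k : ℕ, 0 < c * (1 / 2) ^ (k + 2) := fun k => by positivity
  choose q hq hqle using fun (k : ℕ) (ρ : {ρ : Seminorm 𝕜 (X (n + k + 1)) // Continuous ρ}) =>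
    hp.2 (n + k) ρ.1 ρ.2 _ (hε k)
  let ρ : ∀ k, {ρ : Seminorm 𝕜 (X (n + k + 1)) // Continuous ρ} := fun k =>
    Nat.rec (motive := fun k => {ρ : Seminorm 𝕜 (X (n + k + 1)) // Continuous ρ})
      ⟨r + p (n + 1), Seminorm.continuous_add hr (hp.1 _)⟩
      (fun k ρ => ⟨q k ρ + p (n + k + 2), Seminorm.continuous_add (hq k ρ) (hp.1 _)⟩) k
  have hρ : ∀ k x, (ρ (k + 1)).1 x = q k (ρ k) x + p (n + k + 2) x := fun k x => rfl
  refine ⟨fun k => (ρ k).1, fun k => (ρ k).2, fun x => ?_, fun k x => ?_, fun k x => ?_⟩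
  · exact le_add_of_nonneg_right (apply_nonneg (p (n + 1)) x)
  · cases k with
    | zero => exact le_add_of_nonneg_left (apply_nonneg r x)
    | succ k => exact le_add_of_nonneg_left (apply_nonneg (q k (ρ k)) x)
  · refine (hqle k (ρ k) x).trans ?_
    rw [hρ]
    have := apply_nonneg (p (n + k + 2)) (u (n + k) (n + k + 2) (Nat.le_add_right _ 2) x)
    linarith

theorem Seminorm.continuous_comp_clm {𝕜 X Y : Type*} [RCLike 𝕜] [AddCommGroup X] [Module 𝕜 X]
    [TopologicalSpace X] [AddCommGroup Y] [Module 𝕜 Y] [TopologicalSpace Y] {q : Seminorm 𝕜 Y}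
    (hq : Continuous q) (f : X →L[𝕜] Y) : Continuous (q.comp (f : X →ₗ[𝕜] Y)) :=
  hq.comp f.continuous

theorem Seminorm.apply_sum_le {𝕜 X κ : Type*} [RCLike 𝕜] [AddCommGroup X] [Module 𝕜 X]
    (q : Seminorm 𝕜 X) (s : Finset κ) (f : κ → X) : q (∑ i ∈ s, f i) ≤ ∑ i ∈ s, q (f i) :=
  Finset.le_sum_of_subadditive q (map_zero q).le (map_add_le_add q) s f

/-- Seminorms on `X i` dominating those on the tail `X n, X (n + 1), …` -/
theorem exists_seminorm_dominating (u : ∀ m n, m ≤ n → X m →L[𝕜] X n) (n : ℕ)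
    (B : ∀ k, Seminorm 𝕜 (X (n + k))) (hB : ∀ k, Continuous (B k)) (i : ℕ) :
    ∃ C : Seminorm 𝕜 (X i), Continuous C ∧ ∀ (k : ℕ) (h : i ≤ n + k), i = n + k ∨ k = 0 →
      ∀ d, B k (u i (n + k) h d) ≤ C d := by
  rcases le_or_gt i n with hi | hi
  · refine ⟨(B 0).comp (u i (n + 0) hi : X i →ₗ[𝕜] X (n + 0)),
      Seminorm.continuous_comp_clm (hB 0) _, fun k h hk d => ?_⟩
    obtain rfl : k = 0 := by omega
    exact le_rfl
  · obtain ⟨l, rfl⟩ := Nat.exists_eq_add_of_lt hi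
    refine ⟨(B (l + 1)).comp (u (n + l + 1) (n + (l + 1)) le_rfl : X (n + l + 1) →ₗ[𝕜] _),
      Seminorm.continuous_comp_clm (hB _) _, fun k h hk d => ?_⟩
    obtain rfl : k = l + 1 := by omega
    exact le_rfl

/-- On the unit ball of `p n`, the topology of `X (n + 1)` is coarser than that of the limit. -/
theorem IsSeqLimit.exists_seminorm_lt [∀ n, PolynormableSpace 𝕜 (X n)] (H : IsSeqLimit u j)
    (hp : IsAcyclicSeq u p) (n : ℕ) {r : Seminorm 𝕜 (X (n + 1))} (hr : Continuous r) :
    ∃ w : Seminorm 𝕜 E, Continuous w ∧ ∀ x : X n, p n x ≤ 1 → w (j n x) < 1 →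
      r (u n (n + 1) (Nat.le_succ n) x) < 1 := by
  -- With c = 1/6 the final estimate is 1/6 + 4 · 1/6 < 1.
  obtain ⟨ρ, hρc, hρr, hρp, hρ⟩ := hp.exists_chain n hr (c := 1 / 6) (by norm_num)
  -- B k bounds a summand living in X (n + k) in the three places where it is used: seen by ρ k one
  -- step further, by p, and by the preceding ρ. The index equation k = l + 1 avoids a subtraction
  -- in the types.
  have hB : ∀ k, ∃ B : Seminorm 𝕜 (X (n + k)), Continuous B ∧
      ∀ x, B x ≤ 1 → ρ k (u (n + k) (n + k + 1) (Nat.le_succ _) x) ≤ 1 / 6 * (1 / 2) ^ k ∧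
        p (n + k) x ≤ 1 ∧ ∀ l, (h : k = l + 1) →
          ρ l (u (n + k) (n + l + 1) (by omega) x) ≤ 1 := by
    intro k
    have h0 : ∃ A : Seminorm 𝕜 (X (n + k)), Continuous A ∧ p (n + k) ≤ A ∧
        ∀ l, (h : k = l + 1) → ∀ x, ρ l (u (n + k) (n + l + 1) (by omega) x) ≤ A x := by
      cases k with
      | zero => exact ⟨p n, hp.1 n, le_rfl, fun l h => by simp at h⟩
      | succ k =>
        refine ⟨ρ k, hρc k, hρp k, fun l h x => ?_⟩
        obtain rfl : k = l := by omega
        exact (congrArg (ρ k) (H.map_self (n + k + 1) x)).le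
    obtain ⟨A, hA, hpA, hρA⟩ := h0
    obtain ⟨B, hB, hBe⟩ := Seminorm.exists_continuous_const_mul
      (Seminorm.continuous_comp_clm (hρc k) (u (n + k) (n + k + 1) (Nat.le_succ _)))
      (c := 6 * 2 ^ k) (by positivity)
    refine ⟨A + B, Seminorm.continuous_add hA hB, fun x hx => ?_⟩
    rw [add_apply] at hx
    have hA0 := apply_nonneg A x
    have hB0 := apply_nonneg B x
    refine ⟨?_, (hpA x).trans (by linarith), fun l h => (hρA l h x).trans (by linarith)⟩
    have h2 : 6 * 2 ^ k * ρ k (u (n + k) (n + k + 1) (Nat.le_succ _) x) ≤ 1 :=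
      (hBe x).symm.le.trans (by linarith)
    have h3 : (1 : ℝ) / 6 * (1 / 2) ^ k = 1 / (6 * 2 ^ k) := by
      rw [div_pow, one_pow]; field_simp
    rw [h3, le_div_iff₀ (by positivity)]
    linarith
  choose B hBc hB using hB
  choose C hCc hC using exists_seminorm_dominating u n B hBc
  obtain ⟨w, hw, hwlt⟩ := H.exists_seminorm C hCc
  refine ⟨w, hw, fun x hx hwx => ?_⟩
  obtain ⟨N, d₀, hd₀, hC₀⟩ := hwlt _ hwx
  obtain ⟨d, M, hM, hdM, hd, hCd⟩ : ∃ (d : ∀ i, X i) (M : ℕ), n + 1 ≤ M ∧ (∀ i, M ≤ i → d i = 0) ∧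
      j n x = ∑ i ∈ Finset.range M, j i (d i) ∧ ∑ i ∈ Finset.range M, C i (d i) < 1 := by
    refine ⟨truncSeq N d₀, max N (n + 1), le_max_right _ _,
      fun i hi => truncSeq_of_le _ ((le_max_left _ _).trans hi), ?_, ?_⟩
    · rw [hd₀, sum_truncSeq (fun i => j i) (fun i => map_zero _) (le_max_left _ _)]
    · rwa [sum_truncSeq (fun i => C i) (fun i => map_zero _) (le_max_left _ _)]
  have hsub : ∀ t ⊆ Finset.range M, ∑ i ∈ t, C i (d i) ≤ 1 := fun t ht =>
    (Finset.sum_le_sum_of_subset_of_nonneg ht fun i _ _ => apply_nonneg _ _).trans hCd.le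
  have hCd1 : ∀ i, C i (d i) ≤ 1 := fun i => by
    rcases lt_or_ge i M with hi | hi
    · simpa using hsub {i} (by simpa using hi)
    · simp [hdM i hi]
  -- All summands from steps up to n, collected in X n.
  let D₀ : X n := ∑ i : Fin (n + 1), u i n (Nat.lt_succ_iff.1 i.2) (d i)
  have hD₀ : B 0 D₀ ≤ 1 := by
    refine (Seminorm.apply_sum_le (B 0) _ _).trans ?_
    refine le_trans (Finset.sum_le_sum fun i _ => hC i 0 (Nat.lt_succ_iff.1 i.2) (Or.inr rfl) (d i)) ?_
    rw [← Finset.sum_range (fun i => C i (d i))]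
    exact hsub _ (Finset.range_mono hM)
  have hDk : ∀ k, B (k + 1) (d (n + k + 1)) ≤ 1 := fun k => by
    have h1 := hC (n + k + 1) (k + 1) le_rfl (Or.inl rfl) (d (n + k + 1))
    have h2 : u (n + k + 1) (n + (k + 1)) le_rfl (d (n + k + 1)) = d (n + k + 1) := H.map_self _ _
    rw [h2] at h1
    exact h1.trans (hCd1 _)
  -- s k represents the partial sum of the d i with i ≤ n + k, minus x. Once all d i are included it
  -- has image 0 in E, so it vanishes at a later step; this is the vanishing that the chain estimate
  -- needs.
  let s : ∀ k, X (n + k) := fun k => Nat.rec (motive := fun k => X (n + k)) (D₀ - x)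
    (fun k sk => u (n + k) (n + k + 1) (Nat.le_succ _) sk + d (n + k + 1)) k
  have hs0 : s 0 = D₀ - x := rfl
  have hs : ∀ k, s (k + 1) = u (n + k) (n + k + 1) (Nat.le_succ _) (s k) + d (n + k + 1) :=
    fun k => rfl
  have hjD : j n D₀ = ∑ i ∈ Finset.range (n + 1), j i (d i) := by
    rw [Finset.sum_range, map_sum]
    exact Finset.sum_congr rfl fun i _ => H.apply_map _ _ _ _
  have hjs : ∀ k, j (n + k) (s k) = ∑ i ∈ Finset.range (n + k + 1), j i (d i) - j n x := by
    intro k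
    induction k with
    | zero =>
      rw [hs0, ← hjD]
      exact map_sub (j n) _ _
    | succ k ih =>
      have h1 : j (n + (k + 1)) (s (k + 1)) = j (n + k) (s k) + j (n + k + 1) (d (n + k + 1)) := by
        rw [hs]
        exact (map_add (j (n + k + 1)) _ _).trans (by rw [H.apply_map])
      rw [h1, ih, show n + (k + 1) + 1 = (n + k + 1) + 1 from rfl, Finset.sum_range_succ _ (n + k + 1)]
      abel
  have hjsM : j (n + M) (s M) = 0 := by
    rw [hjs, hd, sub_eq_zero]
    refine (Finset.sum_subset (Finset.range_mono (by omega)) fun i _ hi => ?_).symm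
    rw [hdM i (by simpa using hi), map_zero]
  obtain ⟨m, hm, hsm⟩ := H.exists_map_eq_zero _ _ hjsM
  have hsk : ∀ k (hk : M ≤ k), s k = u (n + M) (n + k) (by omega) (s M) := by
    intro k hk
    induction k, hk using Nat.le_induction with
    | base => exact (H.map_self _ _).symm
    | succ k hk ih =>
      rw [hs, hdM _ (by omega), add_zero, ih]
      exact H.map_map _ _ _ _ _ _
  have hs_zero : ∀ k, m ≤ k → s k = 0 := by
    intro k hk
    rw [hsk k (by omega), ← H.map_map _ m _ hm (by omega), hsm, map_zero]
  have hchain := le_four_mul_of_chain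
    (fun k => ρ k (u (n + k) (n + k + 1) (Nat.le_succ _) (s k))) (fun k => p (n + k) (s k)) (1 / 6)
    (by norm_num) (by norm_num) (fun k => apply_nonneg _ _) ?_ ?_ ?_ ?_
  · have h1 := (hB 0 D₀ hD₀).1
    have h2 : u n (n + 1) (Nat.le_succ n) x =
        u n (n + 1) (Nat.le_succ n) D₀ - u n (n + 1) (Nat.le_succ n) (s 0) := by
      rw [hs0]
      exact (sub_eq_of_eq_add (by rw [← map_add]; congr 1; exact (add_sub_cancel x D₀).symm)).symm
    have h3 : ρ 0 (u n (n + 1) (Nat.le_succ n) x) ≤ 1 / 6 * (1 / 2) ^ 0 + 4 * (1 / 6) := by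
      rw [h2]
      exact (map_sub_le_add (ρ 0) _ _).trans (add_le_add h1 hchain)
    have h4 := hρr (u n (n + 1) (Nat.le_succ n) x)
    norm_num at h3
    linarith
  · have h1 := (hB 0 D₀ hD₀).2.1
    exact (map_sub_le_add (p n) D₀ x).trans (by linarith [show p n D₀ ≤ 1 from h1])
  · intro k
    have h1 := (hB (k + 1) _ (hDk k)).2.2 k rfl
    refine (hρp k _).trans ?_
    refine (map_add_le_add (ρ k) _ _).trans ?_
    have h2 : ρ k (d (n + k + 1)) ≤ 1 := (congrArg (ρ k) (H.map_self (n + k + 1) _)).symm.le.trans h1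
    linarith
  · intro k
    have h1 := hρ k (s k)
    have h2 : ρ (k + 1) (u (n + (k + 1)) (n + (k + 1) + 1) (Nat.le_succ _) (d (n + k + 1))) ≤
        1 / 6 * (1 / 2) ^ (k + 1) := (hB (k + 1) _ (hDk k)).1
    have h3 : u (n + k) (n + k + 2) (Nat.le_add_right _ 2) (s k) =
        u (n + (k + 1)) (n + (k + 1) + 1) (Nat.le_succ _) (s (k + 1)) -
        u (n + (k + 1)) (n + (k + 1) + 1) (Nat.le_succ _) (d (n + k + 1)) := by
      rw [hs, ← H.map_map (n + k) (n + k + 1) (n + k + 2) (Nat.le_succ _) (Nat.le_succ _) (s k)]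
      exact (sub_eq_of_eq_add (map_add (u (n + k + 1) (n + k + 2) (Nat.le_succ _)) _ _)).symm
    have h4 := map_sub_le_add (ρ (k + 1))
      (u (n + (k + 1)) (n + (k + 1) + 1) (Nat.le_succ _) (s (k + 1)))
      (u (n + (k + 1)) (n + (k + 1) + 1) (Nat.le_succ _) (d (n + k + 1)))
    rw [← h3] at h4
    have h5 := h1.trans (add_le_add_right h4 _)
    refine h5.trans ?_
    linarith
  · refine ⟨m, fun k hk => ?_⟩
    simp only [hs_zero k hk, map_zero]

end SeqLimit

/-! ### Disks on which the limit topology lifts to a step -/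

/-- A set containing `0` and closed under absolutely convex combinations. -/
structure IsDisk (𝕜 : Type*) {E : Type*} [RCLike 𝕜] [AddCommGroup E] [Module 𝕜 E] (A : Set E) :
    Prop where
  zero_mem : (0 : E) ∈ A
  combo_mem : ∀ x ∈ A, ∀ y ∈ A, ∀ a b : 𝕜, ‖a‖ + ‖b‖ ≤ 1 → a • x + b • y ∈ A

namespace IsDisk

variable {𝕜 E : Type*} [RCLike 𝕜] [AddCommGroup E] [Module 𝕜 E] {A : Set E}

theorem smul_mem (hA : IsDisk 𝕜 A) {x : E} (hx : x ∈ A) {a : 𝕜} (ha : ‖a‖ ≤ 1) : a • x ∈ A := by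
  simpa using hA.combo_mem x hx x hx a 0 (by simpa using ha)

theorem average_mem (hA : IsDisk 𝕜 A) {x : ℕ → E} {n : ℕ} (hx : ∀ i ≤ n, x i ∈ A) :
    ((n + 1 : ℕ) : 𝕜)⁻¹ • ∑ i ∈ Finset.range (n + 1), x i ∈ A := by
  induction n with
  | zero => simpa using hx 0 le_rfl
  | succ n ih =>
    have h1 := ih fun i hi => hx i (hi.trans n.le_succ)
    have h2 := hA.combo_mem _ h1 _ (hx (n + 1) le_rfl)
      (((n + 1 + 1 : ℕ) : 𝕜)⁻¹ * ((n + 1 : ℕ) : 𝕜)) (((n + 1 + 1 : ℕ) : 𝕜)⁻¹) (by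
        rw [norm_mul, norm_inv, RCLike.norm_natCast, RCLike.norm_natCast]
        have : (0 : ℝ) < ((n + 1 + 1 : ℕ) : ℝ) := by positivity
        field_simp
        push_cast
        linarith)
    rw [Finset.sum_range_succ, smul_add]
    rwa [mul_smul, smul_inv_smul₀ (by exact_mod_cast n.succ_ne_zero)] at h2

theorem add {B : Set E} (hA : IsDisk 𝕜 A) (hB : IsDisk 𝕜 B) :
    IsDisk 𝕜 {z | ∃ x ∈ A, ∃ y ∈ B, x + y = z} where
  zero_mem := ⟨0, hA.zero_mem, 0, hB.zero_mem, by simp⟩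
  combo_mem := by
    rintro _ ⟨x, hx, y, hy, rfl⟩ _ ⟨x', hx', y', hy', rfl⟩ a b hab
    exact ⟨_, hA.combo_mem x hx x' hx' a b hab, _, hB.combo_mem y hy y' hy' a b hab, by
      simp only [smul_add]; abel⟩

end IsDisk

section SeqLimit

variable {𝕜 : Type*} [RCLike 𝕜] {X : ℕ → Type*} [∀ n, AddCommGroup (X n)] [∀ n, Module 𝕜 (X n)]
  [∀ n, TopologicalSpace (X n)] {E : Type*} [AddCommGroup E] [Module 𝕜 E] [TopologicalSpace E]
  {u : ∀ m n, m ≤ n → X m →L[𝕜] X n} {j : ∀ n, X n →L[𝕜] E} {p : ∀ n, Seminorm 𝕜 (X n)}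

/-- Elements of `A` that are small in `E` lift to small elements of `X (n + 1)`. -/
def LiftsOn (j : ∀ n, X n →L[𝕜] E) (n : ℕ) (A : Set E) : Prop :=
  ∀ r : Seminorm 𝕜 (X (n + 1)), Continuous r → ∃ w : Seminorm 𝕜 E, Continuous w ∧
    ∀ y ∈ A, w y < 1 → ∃ x, j (n + 1) x = y ∧ r x < 1

theorem isDisk_image_ball (j : ∀ n, X n →L[𝕜] E) (n : ℕ) (q : Seminorm 𝕜 (X n)) :
    IsDisk 𝕜 {y | ∃ x, q x ≤ 1 ∧ j n x = y} where
  zero_mem := ⟨0, by simp⟩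
  combo_mem := by
    rintro _ ⟨x, hx, rfl⟩ _ ⟨y, hy, rfl⟩ a b hab
    refine ⟨a • x + b • y, ?_, by simp⟩
    refine (map_add_le_add q _ _).trans ?_
    rw [map_smul_eq_mul, map_smul_eq_mul]
    nlinarith [norm_nonneg a, norm_nonneg b, apply_nonneg q x, apply_nonneg q y]

/-- A is enlarged by the image of a ball so small that, if y + j x is small in E with y in A, then y
itself is small and lifts to x' with p (n + 1) x' < 1. Then (x' + x) / 2 lies in the unit ball of p
(n + 1), where `exists_seminorm_lt` applies. -/
theorem IsSeqLimit.exists_disk_succ [∀ n, PolynormableSpace 𝕜 (X n)] (H : IsSeqLimit u j)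
    (hp : IsAcyclicSeq u p) (n : ℕ) {A : Set E} (hA : IsDisk 𝕜 A) (hAn : LiftsOn j n A) :
    ∃ A' : Set E, (IsDisk 𝕜 A' ∧ LiftsOn j (n + 1) A') ∧ A ⊆ A' ∧
      ∃ P : Seminorm 𝕜 (X (n + 1)), Continuous P ∧ ∀ x, P x ≤ 1 → j (n + 1) x ∈ A' := by
  obtain ⟨w, hw, hwA⟩ := hAn (p (n + 1)) (hp.1 _)
  -- The factor 2 gives w (j x) ≤ 1/2 on the unit ball of P; the bound w (y + j x) < 1/2 from w'
  -- supplies the other half.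
  obtain ⟨q, hq, hqe⟩ := Seminorm.exists_continuous_const_mul
    (Seminorm.continuous_comp_clm hw (j (n + 1))) (c := 2) zero_le_two
  have hqe : ∀ x, q x = 2 * w (j (n + 1) x) := hqe
  let P : Seminorm 𝕜 (X (n + 1)) := p (n + 1) + q
  have hP : ∀ x, P x = p (n + 1) x + q x := fun x => rfl
  refine ⟨_, ⟨hA.add (isDisk_image_ball j (n + 1) P), fun r hr => ?_⟩,
    fun x hx => ⟨x, hx, 0, ⟨0, by simp⟩, by simp⟩, P, Seminorm.continuous_add (hp.1 _) hq,
    fun x hx => ⟨0, hA.zero_mem, _, ⟨x, hx, rfl⟩, by simp⟩⟩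
  obtain ⟨r', hr', hre⟩ := Seminorm.exists_continuous_const_mul hr (c := 2) zero_le_two
  obtain ⟨v, hv, hvr⟩ := H.exists_seminorm_lt hp (n + 1) hr'
  obtain ⟨w', hw', hwe⟩ := Seminorm.exists_continuous_const_mul hw (c := 2) zero_le_two
  refine ⟨w' + v, Seminorm.continuous_add hw' hv, ?_⟩
  rintro _ ⟨y, hy, _, ⟨x, hx, rfl⟩, rfl⟩ hlt
  rw [add_apply, hwe] at hlt
  rw [hP, hqe] at hx
  have h1 := apply_nonneg w (y + j (n + 1) x)
  have h2 := apply_nonneg v (y + j (n + 1) x)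
  have h3 := apply_nonneg w (j (n + 1) x)
  have h4 := apply_nonneg (p (n + 1)) x
  have h5 : w y ≤ w (y + j (n + 1) x) + w (j (n + 1) x) := by
    simpa using map_sub_le_add w (y + j (n + 1) x) (j (n + 1) x)
  obtain ⟨x', rfl, hx'⟩ := hwA y hy (by linarith)
  have h6 := map_add_le_add (p (n + 1)) x' x
  have hn : ‖(2 : 𝕜)⁻¹‖ = 2⁻¹ := by simp
  have h7 := hvr ((2 : 𝕜)⁻¹ • (x' + x))
    (by rw [map_smul_eq_mul, hn]; linarith)
    (by rw [map_smul, map_smul_eq_mul, hn, map_add]; linarith)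
  rw [hre, map_smul, map_smul_eq_mul, hn] at h7
  exact ⟨u (n + 1) (n + 1 + 1) (Nat.le_succ _) (x' + x), by rw [H.apply_map, map_add],
    by linarith⟩

theorem IsSeqLimit.exists_disks [∀ n, PolynormableSpace 𝕜 (X n)] (H : IsSeqLimit u j)
    (hp : IsAcyclicSeq u p) :
    ∃ (A : ℕ → Set E) (P : ∀ n, Seminorm 𝕜 (X n)), Monotone A ∧ (∀ n, IsDisk 𝕜 (A n)) ∧
      (∀ n, LiftsOn j n (A n)) ∧ (∀ n, Continuous (P n)) ∧ ∀ n x, P n x ≤ 1 → j n x ∈ A n := by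
  choose S hS hsub P hPc hP using fun (n : ℕ) (A : {A : Set E // IsDisk 𝕜 A ∧ LiftsOn j n A}) =>
    H.exists_disk_succ hp n A.2.1 A.2.2
  have h0 : LiftsOn j 0 {y | ∃ x, p 0 x ≤ 1 ∧ j 0 x = y} := by
    intro r hr
    obtain ⟨w, hw, hwr⟩ := H.exists_seminorm_lt hp 0 hr
    refine ⟨w, hw, ?_⟩
    rintro _ ⟨x, hx, rfl⟩ hlt
    exact ⟨_, H.apply_map _ _ _ _, hwr x hx hlt⟩
  let A : ∀ n, {A : Set E // IsDisk 𝕜 A ∧ LiftsOn j n A} := fun n =>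
    Nat.rec (motive := fun n => {A : Set E // IsDisk 𝕜 A ∧ LiftsOn j n A})
      ⟨_, isDisk_image_ball j 0 (p 0), h0⟩ (fun n A => ⟨S n A, hS n A⟩) n
  have hA : ∀ n, (A (n + 1)).1 = S n (A n) := fun n => rfl
  have hex : ∀ n, ∃ Q : Seminorm 𝕜 (X n), Continuous Q ∧ ∀ x, Q x ≤ 1 → j n x ∈ (A n).1 := by
    intro n
    cases n with
    | zero => exact ⟨p 0, hp.1 0, fun x hx => ⟨x, hx, rfl⟩⟩
    | succ n => exact ⟨P n (A n), hPc n (A n), hP n (A n)⟩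
  choose Q hQc hQ using hex
  exact ⟨fun n => (A n).1, Q, monotone_nat_of_le_succ fun n => hsub n (A n), fun n => (A n).2.1,
    fun n => (A n).2.2, hQc, hQ⟩

/-- Otherwise each multiple 2(n + 1) A n is separated from some member of the filter by some w n. A
single seminorm on E that charges P i + W i on the i-th step, with W i ≥ w i increasing, splits a
small difference into a head absorbed by the disk and a tail that is w n-small. -/
theorem IsSeqLimit.exists_trace [∀ n, PolynormableSpace 𝕜 (X n)] (H : IsSeqLimit u j)
    {A : ℕ → Set E} {P : ∀ n, Seminorm 𝕜 (X n)} (hAm : Monotone A) (hA : ∀ n, IsDisk 𝕜 (A n))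
    (hPc : ∀ n, Continuous (P n)) (hP : ∀ n x, P n x ≤ 1 → j n x ∈ A n)
    {𝓕 : Filter E} [𝓕.NeBot]
    (h𝓕 : ∀ w : Seminorm 𝕜 E, Continuous w → ∃ F ∈ 𝓕, ∀ x ∈ F, ∀ y ∈ F, w (x - y) < 1) :
    ∃ n : ℕ, ∀ w : Seminorm 𝕜 E, Continuous w → ∀ F ∈ 𝓕, ∃ y ∈ F, ∃ z,
      ((2 * (n + 1) : ℕ) : 𝕜)⁻¹ • z ∈ A n ∧ w (y - z) < 1 := by
  by_contra! hcon
  choose w hw F hF hFw using hcon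
  obtain ⟨W, hWm, hWc, hW⟩ := Seminorm.exists_monotone_le w hw
  obtain ⟨v, hv, hvy⟩ := H.exists_seminorm
    (fun i => P i + (W i).comp (j i : X i →ₗ[𝕜] E))
    (fun i => Seminorm.continuous_add (hPc i) (Seminorm.continuous_comp_clm (hWc i) _))
  obtain ⟨G, hG, hGv⟩ := h𝓕 v hv
  obtain ⟨x, hx⟩ := Filter.nonempty_of_mem hG
  obtain ⟨m, x, rfl⟩ := H.exists_eq x
  obtain ⟨l, hl⟩ := exists_nat_ge (P m x)
  -- The index is fixed only after the point x of G: it must exceed both the step of x and the size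
  -- of x there, so that x lies in (n + 1) A n.
  let n := max m l
  have hn0 : ((n + 1 : ℕ) : 𝕜) ≠ 0 := by exact_mod_cast n.succ_ne_zero
  have hxn : ((n + 1 : ℕ) : 𝕜)⁻¹ • j m x ∈ A n := by
    refine hAm (le_max_left m l) ?_
    rw [← map_smul]
    refine hP _ _ ?_
    rw [map_smul_eq_mul, norm_inv, RCLike.norm_natCast, inv_mul_le_iff₀ (by positivity), mul_one]
    have : (l : ℝ) ≤ n := by exact_mod_cast le_max_right m l
    push_cast
    linarith
  obtain ⟨y, hyG, hyF⟩ := Filter.nonempty_of_mem (Filter.inter_mem hG (hF n))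
  obtain ⟨N, d, hd, hCd⟩ := hvy _ (hGv y hyG _ hx)
  rw [← sum_truncSeq (fun i => j i) (fun i => map_zero _) (Nat.le_add_left N (n + 1)),
    Finset.sum_range_add] at hd
  rw [← sum_truncSeq (fun i => ⇑(P i + (W i).comp (j i : X i →ₗ[𝕜] E))) (fun i => map_zero _)
    (Nat.le_add_left N (n + 1))] at hCd
  generalize truncSeq N d = e at hd hCd
  have hsub : ∀ t ⊆ Finset.range (n + 1 + N), ∑ i ∈ t, (P i (e i) + W i (j i (e i))) < 1 :=
    fun t ht => lt_of_le_of_lt (Finset.sum_le_sum_of_subset_of_nonneg ht fun i _ _ =>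
      apply_nonneg (P i + (W i).comp (j i : X i →ₗ[𝕜] E)) (e i)) hCd
  have hz : ((n + 1 : ℕ) : 𝕜)⁻¹ • ∑ i ∈ Finset.range (n + 1), j i (e i) ∈ A n := by
    refine (hA n).average_mem fun i hi => hAm hi (hP i _ ?_)
    have := hsub {i} (by simp; omega)
    rw [Finset.sum_singleton] at this
    linarith [apply_nonneg (W i) (j i (e i))]
  have hD := (hA n).combo_mem _ hxn _ hz (2 : 𝕜)⁻¹ (2 : 𝕜)⁻¹ (by norm_num)
  -- The approximant is x plus the head of y - x. Each of the two lies in (n + 1) A n, the head as a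
  -- sum of n + 1 elements of A n.
  have h1 := hFw n y hyF (j m x + ∑ i ∈ Finset.range (n + 1), j i (e i)) (by
    convert hD using 1
    push_cast
    rw [mul_inv, mul_smul, smul_add, smul_add])
  have h2 : y - (j m x + ∑ i ∈ Finset.range (n + 1), j i (e i)) =
      ∑ i ∈ Finset.range N, j (n + 1 + i) (e (n + 1 + i)) := by
    rw [sub_add_eq_sub_sub, hd]; abel
  rw [h2] at h1
  have h3 : ∑ i ∈ Finset.range N, w n (j (n + 1 + i) (e (n + 1 + i))) ≤
      ∑ i ∈ Finset.range N,
        (P (n + 1 + i) (e (n + 1 + i)) + W (n + 1 + i) (j (n + 1 + i) (e (n + 1 + i)))) := by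
    refine Finset.sum_le_sum fun i _ => ?_
    have h4 := hW n (j (n + 1 + i) (e (n + 1 + i)))
    have h5 := hWm (show n ≤ n + 1 + i by omega) (j (n + 1 + i) (e (n + 1 + i)))
    linarith [apply_nonneg (P (n + 1 + i)) (e (n + 1 + i))]
  have h6 := hsub _ (Finset.Subset.refl _)
  rw [Finset.sum_range_add] at h6
  have h7 : 0 ≤ ∑ i ∈ Finset.range (n + 1), (P i (e i) + W i (j i (e i))) :=
    Finset.sum_nonneg fun i _ => add_nonneg (apply_nonneg _ _) (apply_nonneg _ _)
  linarith [Seminorm.apply_sum_le (w n) (Finset.range N) fun i => j (n + 1 + i) (e (n + 1 + i))]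

theorem LiftsOn.subset_range {n : ℕ} {A : Set E} (hAn : LiftsOn j n A) (hA : IsDisk 𝕜 A) {y : E}
    (hy : y ∈ A) : ∃ x, j (n + 1) x = y := by
  -- With r = 0 only the existence of a lift matters; scaling y by 1 / (w y + 1) makes it small
  -- enough.
  obtain ⟨w, -, hwA⟩ := hAn 0 continuous_const
  have h0 : 0 < w y + 1 := by have := apply_nonneg w y; linarith
  have hn : ‖((w y + 1 : ℝ) : 𝕜)⁻¹‖ = (w y + 1)⁻¹ := by
    rw [norm_inv, RCLike.norm_ofReal, abs_of_pos h0]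
  have h1 : ((w y + 1 : ℝ) : 𝕜) ≠ 0 := by exact_mod_cast h0.ne'
  obtain ⟨x, hx, -⟩ := hwA (((w y + 1 : ℝ) : 𝕜)⁻¹ • y)
    (hA.smul_mem hy (by rw [hn]; exact inv_le_one_of_one_le₀ (by linarith [apply_nonneg w y])))
    (by rw [map_smul_eq_mul, hn, inv_mul_lt_iff₀ h0]; linarith)
  exact ⟨((w y + 1 : ℝ) : 𝕜) • x, by rw [map_smul, hx, smul_inv_smul₀ h1]⟩

theorem LiftsOn.exists_sub {n : ℕ} {A : Set E} (hAn : LiftsOn j n A) (hA : IsDisk 𝕜 A) {c : ℕ}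
    (hc : c ≠ 0) {r : Seminorm 𝕜 (X (n + 1))} (hr : Continuous r) :
    ∃ w : Seminorm 𝕜 E, Continuous w ∧ ∀ z z', (c : 𝕜)⁻¹ • z ∈ A → (c : 𝕜)⁻¹ • z' ∈ A →
      w (z - z') < 1 → ∃ x, j (n + 1) x = z - z' ∧ r x < 1 := by
  have hc1 : (1 : ℝ) ≤ c := by exact_mod_cast Nat.one_le_iff_ne_zero.2 hc
  have hc0 : (c : 𝕜) ≠ 0 := by exact_mod_cast hc
  obtain ⟨r', hr', hre⟩ := Seminorm.exists_continuous_const_mul hr (c := 2 * c) (by positivity)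
  obtain ⟨w, hw, hwA⟩ := hAn r' hr'
  refine ⟨w, hw, fun z z' hz hz' hlt => ?_⟩
  -- (z - z') / (2c) lies in A, which explains the factor 2c in r'.
  have h1 := hA.combo_mem _ hz _ hz' (2 : 𝕜)⁻¹ (-(2 : 𝕜)⁻¹) (by norm_num)
  have h2 : (2 : 𝕜)⁻¹ • (c : 𝕜)⁻¹ • z + -(2 : 𝕜)⁻¹ • (c : 𝕜)⁻¹ • z' =
      (2 * c : 𝕜)⁻¹ • (z - z') := by
    rw [smul_smul, smul_smul, mul_inv, smul_sub, neg_mul, neg_smul, sub_eq_add_neg]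
  have hn : ‖(2 * c : 𝕜)⁻¹‖ = (2 * c : ℝ)⁻¹ := by simp
  rw [h2] at h1
  obtain ⟨x, hx, hrx⟩ := hwA _ h1 (by
    rw [map_smul_eq_mul, hn, inv_mul_lt_iff₀ (by positivity)]; linarith)
  refine ⟨(2 * c : 𝕜) • x, by rw [map_smul, hx, smul_inv_smul₀ (by simpa using hc0)], ?_⟩
  have hn' : ‖(2 * c : 𝕜)‖ = (2 * c : ℝ) := by simp
  rw [map_smul_eq_mul, hn', ← hre]
  exact hrx

end SeqLimit

/-! ### Completeness of acyclic sequential limits -/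

theorem cauchySeq_of_seminorm {𝕜 Y : Type*} [RCLike 𝕜] [AddCommGroup Y] [Module 𝕜 Y]
    [UniformSpace Y] [IsUniformAddGroup Y] [PolynormableSpace 𝕜 Y] {t : ℕ → Y}
    {r : ℕ → Seminorm 𝕜 Y} (hr : Monotone r)
    (hcof : ∀ p : Seminorm 𝕜 Y, Continuous p → ∃ n, p ≤ r n)
    (ht : ∀ k, r k (t (k + 1) - t k) ≤ (1 / 2) ^ k) : CauchySeq t := by
  have h1 : ∀ m k i, m ≤ k → r m (t (k + i) - t k) ≤ 2 * (1 / 2) ^ k - 2 * (1 / 2) ^ (k + i) := by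
    intro m k i hmk
    induction i with
    | zero => simp
    | succ i ih =>
      have h2 : r m (t (k + i + 1) - t (k + i)) ≤ (1 / 2) ^ (k + i) :=
        (hr (show m ≤ k + i by omega) _).trans (ht _)
      have h3 := map_add_le_add (r m) (t (k + i + 1) - t (k + i)) (t (k + i) - t k)
      rw [sub_add_sub_cancel] at h3
      have h4 : (2 : ℝ) * (1 / 2) ^ (k + (i + 1)) = (1 / 2) ^ (k + i) := by ring
      rw [h4]
      show r m (t (k + i + 1) - t k) ≤ _
      linarith
  rw [cauchySeq_iff]
  intro V hV
  rw [uniformity_eq_comap_nhds_zero] at hV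
  obtain ⟨U, hU, hUV⟩ := hV
  obtain ⟨p, hp, hpU⟩ := PolynormableSpace.exists_seminorm_lt_one_subset 𝕜 hU
  obtain ⟨m, hm⟩ := hcof p hp
  refine ⟨m + 3, fun k hk l hl => hUV (hpU _ ?_)⟩
  have hle : ∀ k, m + 3 ≤ k → p (t k - t (m + 3)) ≤ 1 / 4 := by
    intro k hk
    obtain ⟨i, rfl⟩ := Nat.exists_eq_add_of_le hk
    refine ((hm _).trans (h1 m (m + 3) i (by omega))).trans ?_
    have h2 : (0 : ℝ) ≤ 2 * (1 / 2) ^ (m + 3 + i) := by positivity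
    have h3 : ((1 : ℝ) / 2) ^ m ≤ 1 := pow_le_one₀ (by norm_num) (by norm_num)
    have h4 : (2 : ℝ) * (1 / 2) ^ (m + 3) = 1 / 4 * (1 / 2) ^ m := by ring
    linarith
  have h2 := map_sub_le_add p (t l - t (m + 3)) (t k - t (m + 3))
  rw [sub_sub_sub_cancel_right] at h2
  have := hle k hk
  have := hle l hl
  show p (t l - t k) < 1
  linarith

section SeqLimit

variable {𝕜 : Type*} [RCLike 𝕜] {X : ℕ → Type*} [∀ n, AddCommGroup (X n)] [∀ n, Module 𝕜 (X n)]
  [∀ n, UniformSpace (X n)] {E : Type*} [AddCommGroup E] [Module 𝕜 E] [TopologicalSpace E]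
  {u : ∀ m n, m ≤ n → X m →L[𝕜] X n} {j : ∀ n, X n →L[𝕜] E} {p : ∀ n, Seminorm 𝕜 (X n)}

/-- Acyclic sequential inductive limits of Fréchet spaces are complete. -/
theorem IsSeqLimit.exists_limit [∀ n, PolynormableSpace 𝕜 (X n)] [∀ n, IsUniformAddGroup (X n)]
    [∀ n, CompleteSpace (X n)] [∀ n, FirstCountableTopology (X n)] (H : IsSeqLimit u j)
    (hp : IsAcyclicSeq u p) {𝓕 : Filter E} [𝓕.NeBot]
    (h𝓕 : ∀ w : Seminorm 𝕜 E, Continuous w → ∃ F ∈ 𝓕, ∀ x ∈ F, ∀ y ∈ F, w (x - y) < 1) :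
    ∃ x, ∀ w : Seminorm 𝕜 E, Continuous w → ∀ᶠ y in 𝓕, w (y - x) < 1 := by
  obtain ⟨A, P, hAm, hA, hAl, hPc, hP⟩ := H.exists_disks hp
  obtain ⟨n, hn⟩ := H.exists_trace hAm hA hPc hP h𝓕
  generalize hc : 2 * (n + 1) = c at hn
  have hc0 : c ≠ 0 := by omega
  obtain ⟨r, hrm, hrc, hrcof⟩ := PolynormableSpace.exists_seq_seminorm 𝕜 (X (n + 1))
  have hw : ∀ k : ℕ, ∃ w : Seminorm 𝕜 E, Continuous w ∧ ∀ z z', (c : 𝕜)⁻¹ • z ∈ A n →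
      (c : 𝕜)⁻¹ • z' ∈ A n → w (z - z') < 1 →
      ∃ x, j (n + 1) x = z - z' ∧ r k x ≤ (1 / 2) ^ k := by
    intro k
    obtain ⟨q, hq, hqe⟩ := Seminorm.exists_continuous_const_mul (hrc k) (c := 2 ^ k) (by positivity)
    obtain ⟨w, hw, hwx⟩ := (hAl n).exists_sub (hA n) hc0 hq
    refine ⟨w, hw, fun z z' hz hz' hlt => ?_⟩
    obtain ⟨x, hx, hqx⟩ := hwx z z' hz hz' hlt
    refine ⟨x, hx, ?_⟩
    rw [hqe] at hqx
    rw [div_pow, one_pow, le_div_iff₀ (by positivity)]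
    linarith
  choose w hwc hw using hw
  -- The factor 3 allows the three-term splitting in `hwlift`.
  choose w3 hw3c hw3 using fun k =>
    Seminorm.exists_continuous_const_mul (hwc k) (c := 3) (by norm_num)
  obtain ⟨W, hWm, hWc, hwW⟩ := Seminorm.exists_monotone_le w3 hw3c
  have hWlt : ∀ k l x, k ≤ l → W l x < 1 → w k x < 1 / 3 := fun k l x hkl hlt => by
    have h1 := hw3 k x
    have h2 := hwW k x
    have h3 := hWm hkl x
    linarith
  choose G hG hGW using fun k => h𝓕 (W k) (hWc k)
  -- Intersecting the first k + 1 sets puts y k and y (k + 1) in the common set G k.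
  have hGi : ∀ k, ⋂ i ∈ Finset.range (k + 1), G i ∈ 𝓕 := fun k =>
    (Filter.biInter_finset_mem _).2 fun i _ => hG i
  choose y hyG z hz hyz using fun k => hn (W k) (hWc k) _ (hGi k)
  have hyG' : ∀ i k, i ≤ k → y k ∈ G i := fun i k hik => by
    have := hyG k
    simp only [Set.mem_iInter] at this
    exact this i (Finset.mem_range.2 (by omega))
  have hwlift : ∀ k l y' z', k ≤ l → y' ∈ G k → (c : 𝕜)⁻¹ • z' ∈ A n → W l (y' - z') < 1 →
      w k (z' - z k) < 1 := by
    intro k l y' z' hkl hy' _ hlt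
    have h1 := hWlt k l _ hkl hlt
    have h2 := hWlt k k _ le_rfl (hyz k)
    have h3 := hWlt k k _ le_rfl (hGW k y' hy' (y k) (hyG' k k le_rfl))
    have h4 : z' - z k = (y' - y k) + (y k - z k) - (y' - z') := by abel
    rw [h4]
    have h5 := map_sub_le_add (w k) ((y' - y k) + (y k - z k)) (y' - z')
    have h6 := map_add_le_add (w k) (y' - y k) (y k - z k)
    linarith
  choose x hx hrx using fun k => hw k (z (k + 1)) (z k) (hz _) (hz _)
    (hwlift k (k + 1) _ _ k.le_succ (hyG' k (k + 1) k.le_succ) (hz _) (hyz _))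
  obtain ⟨t₀, ht₀⟩ : ∃ t₀, j (n + 1) t₀ = z 0 := by
    obtain ⟨t, ht⟩ := (hAl n).subset_range (hA n) (hz 0)
    exact ⟨(c : 𝕜) • t, by rw [map_smul, ht, smul_inv_smul₀ (by exact_mod_cast hc0)]⟩
  let t : ℕ → X (n + 1) := fun k => Nat.rec t₀ (fun k s => s + x k) k
  have ht : ∀ k, t (k + 1) = t k + x k := fun k => rfl
  have hjt : ∀ k, j (n + 1) (t k) = z k := by
    intro k
    induction k with
    | zero => exact ht₀
    | succ k ih => rw [ht, map_add, ih, hx]; abel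
  obtain ⟨s, hs⟩ := cauchySeq_tendsto_of_complete
    (cauchySeq_of_seminorm (t := t) hrm hrcof fun k => by
      rw [ht, add_sub_cancel_left]; exact hrx k)
  refine ⟨j (n + 1) s, fun v hv => ?_⟩
  -- The factor 4 serves the path a, b, z', z k, j s: two filter points, two points of the multiple
  -- of A n, and the limit.
  obtain ⟨v4, hv4, hv4e⟩ := Seminorm.exists_continuous_const_mul hv (c := 4) (by norm_num)
  obtain ⟨K, hK⟩ := hrcof _ (Seminorm.continuous_comp_clm hv4 (j (n + 1)))
  have hlim : ∀ᶠ k in Filter.atTop, v4 (j (n + 1) (t k - s)) < 1 := by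
    have h1 : Filter.Tendsto (fun k => v4 (j (n + 1) (t k - s))) Filter.atTop (𝓝 0) := by
      have h2 : Continuous fun a => v4 (j (n + 1) (a - s)) :=
        hv4.comp ((j (n + 1)).continuous.comp (continuous_id.sub continuous_const))
      simpa [Function.comp_def] using (h2.tendsto s).comp hs
    exact h1.eventually_lt_const one_pos
  obtain ⟨k, hks, hkK⟩ := (hlim.and (Filter.eventually_ge_atTop (K + 1))).exists
  obtain ⟨F, hF, hFv⟩ := h𝓕 _ (Seminorm.continuous_add hv4 (hWc k))
  filter_upwards [hF] with a ha
  obtain ⟨b, hb, z', hz', hbz'⟩ := hn _ (Seminorm.continuous_add hv4 (hWc k)) _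
    (Filter.inter_mem hF (hG k))
  have h1 := hFv a ha b hb.1
  rw [add_apply] at h1 hbz'
  have h2 := apply_nonneg (W k) (a - b)
  have h3 := apply_nonneg (W k) (b - z')
  have h4 := apply_nonneg v4 (b - z')
  obtain ⟨x', hx', hrx'⟩ := hw k z' (z k) hz' (hz k)
    (hwlift k k b z' le_rfl hb.2 hz' (by linarith))
  have h5 : v4 (z' - z k) ≤ 1 / 2 := by
    rw [← hx']
    refine (hK x').trans ((hrm (show K ≤ k by omega) x').trans (hrx'.trans ?_))
    obtain ⟨k, rfl⟩ : ∃ l, k = l + 1 := ⟨k - 1, by omega⟩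
    rw [pow_succ]
    have : ((1 : ℝ) / 2) ^ k ≤ 1 := pow_le_one₀ (by norm_num) (by norm_num)
    linarith
  rw [map_sub, hjt] at hks
  have h6 : a - j (n + 1) s = (a - b) + (b - z') + (z' - z k) + (z k - j (n + 1) s) := by abel
  have h7 := map_add_le_add v4 ((a - b) + (b - z') + (z' - z k)) (z k - j (n + 1) s)
  have h8 := map_add_le_add v4 ((a - b) + (b - z')) (z' - z k)
  have h9 := map_add_le_add v4 (a - b) (b - z')
  rw [← h6, hv4e] at h7
  linarith

end SeqLimit

/-! ### Universal property of the locally convex inductive limit -/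

namespace Seminorm

variable {𝕜 Y : Type*} [RCLike 𝕜] [AddCommGroup Y] [Module 𝕜 Y] (P : Seminorm 𝕜 Y)

/-- The topology generated by a single seminorm. -/
@[reducible] def topology : TopologicalSpace Y :=
  SeminormFamily.moduleFilterBasis (fun _ : Unit => P) |>.topology

theorem polynormableSpace_topology : PolynormableSpace 𝕜 Y (topology := P.topology) :=
  letI := P.topology
  WithSeminorms.toPolynormableSpace (p := fun _ : Unit => P) ⟨rfl⟩

theorem continuous_topology : Continuous[P.topology, inferInstance] P :=
  letI := P.topology
  WithSeminorms.continuous_seminorm (p := fun _ : Unit => P) ⟨rfl⟩ ()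

theorem continuous_to_topology {Z : Type*} [AddCommGroup Z] [Module 𝕜 Z] [TopologicalSpace Z]
    [IsTopologicalAddGroup Z] (f : Z →ₗ[𝕜] Y) (hf : Continuous (P.comp f)) :
    Continuous[inferInstance, P.topology] f :=
  letI := P.topology
  WithSeminorms.continuous_of_continuous_comp (q := fun _ : Unit => P) ⟨rfl⟩ f fun _ => hf

end Seminorm

namespace LCLimit

variable {𝕜 : Type*} [RCLike 𝕜] {ι : Type*} [LinearOrder ι] {G : ι → Type*}
  [∀ k, AddCommGroup (G k)] [∀ k, Module 𝕜 (G k)]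

section Basic

variable [∀ k, TopologicalSpace (G k)] (f : ∀ k l, k ≤ l → G k →L[𝕜] G l)

instance : IsTopologicalAddGroup (LCLimit f) :=
  (PolynormableSpace.withSeminorms 𝕜 _).topologicalAddGroup

instance : ContinuousSMul 𝕜 (LCLimit f) :=
  (PolynormableSpace.withSeminorms 𝕜 _).continuousSMul

theorem of_map (k l : ι) (h : k ≤ l) (x : G k) : of f l (f k l h x) = of f k x :=
  Module.DirectLimit.of_f (R := 𝕜) (ι := ι) (G := G)
    (f := fun k l h => (f k l h : G k →ₗ[𝕜] G l))

theorem exists_of [Nonempty ι] (y : LCLimit f) : ∃ k x, of f k x = y :=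
  Module.DirectLimit.exists_of y

variable {f} in
theorem exists_map_eq_zero (hself : ∀ k x, f k k le_rfl x = x)
    (hmap : ∀ k l m (hkl : k ≤ l) (hlm : l ≤ m) x, f l m hlm (f k l hkl x) = f k m (hkl.trans hlm) x)
    [Nonempty ι] {k : ι} {x : G k} (h : of f k x = 0) : ∃ l, ∃ h : k ≤ l, f k l h x = 0 := by
  have : DirectedSystem G fun k l h => (f k l h : G k →ₗ[𝕜] G l) :=
    ⟨fun k x => hself k x, fun k l m hkl hlm x => hmap _ _ _ _ _ x⟩
  exact Module.DirectLimit.of.zero_exact (R := 𝕜) (f := fun k l h => (f k l h : G k →ₗ[𝕜] G l)) h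

/-- The topology generated by P alone is one of the locally convex topologies whose infimum defines
that of the limit. -/
theorem seminorm_continuous [∀ k, IsTopologicalAddGroup (G k)] (P : Seminorm 𝕜 (LCLimit f))
    (h : ∀ k, Continuous (P.comp (of f k : G k →ₗ[𝕜] LCLimit f))) : Continuous P := by
  have hle : sInf {t : TopologicalSpace (LCLimit f) | PolynormableSpace 𝕜 (LCLimit f) (topology := t) ∧
      ∀ k, Continuous[inferInstance, t] (ofLinear f k)} ≤ P.topology :=
    sInf_le ⟨P.polynormableSpace_topology, fun k => P.continuous_to_topology (ofLinear f k) (h k)⟩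
  exact continuous_le_dom hle P.continuous_topology

theorem continuous_linearMap [∀ k, IsTopologicalAddGroup (G k)] {Y : Type*} [AddCommGroup Y]
    [Module 𝕜 Y] [TopologicalSpace Y] [PolynormableSpace 𝕜 Y] (T : LCLimit f →ₗ[𝕜] Y)
    (h : ∀ k, Continuous fun x => T (of f k x)) : Continuous T :=
  continuous_of_seminorm T fun _ hp => seminorm_continuous f _ fun k => hp.comp (h k)

end Basic

/-! ### Compact regularity implies Hausdorff -/

section Hausdorff

variable [∀ k, TopologicalSpace (G k)] {f : ∀ k l, k ≤ l → G k →L[𝕜] G l}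

/-- The set of irrational numbers is not a countable union of closed sets. -/
theorem _root_.not_iUnion_isClosed_eq_irrational {κ : Type*} [Countable κ] (T : κ → Set ℝ)
    (hT : ∀ i, IsClosed (T i)) (h : ⋃ i, T i = {t | Irrational t}) : False := by
  let S : κ ⊕ ℚ → Set ℝ := Sum.elim T fun q => {(q : ℝ)}
  have hS : ∀ i, IsClosed (S i) := by
    rintro (i | q)
    · exact hT i
    · exact isClosed_singleton
  have hU : ⋃ i, S i = Set.univ := by
    refine Set.eq_univ_of_forall fun t => ?_
    by_cases ht : Irrational t
    · obtain ⟨i, hi⟩ := Set.mem_iUnion.1 (h.symm ▸ ht : t ∈ ⋃ i, T i)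
      exact Set.mem_iUnion.2 ⟨Sum.inl i, hi⟩
    · obtain ⟨q, rfl⟩ := not_not.1 ht
      exact Set.mem_iUnion.2 ⟨Sum.inr q, rfl⟩
  obtain ⟨i | q, hi⟩ := nonempty_interior_of_iUnion_of_closed hS hU
  · obtain ⟨q, hq⟩ := Rat.denseRange_cast.exists_mem_open isOpen_interior hi
    have : (q : ℝ) ∈ {t : ℝ | Irrational t} := h ▸ Set.mem_iUnion.2 ⟨i, interior_subset hq⟩
    exact q.not_irrational this
  · simp [S] at hi

/-- All points of S are inseparable, so every proper filter on S converges to each of them. -/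
theorem _root_.isCompact_of_subset_closure_singleton {Y : Type*} [TopologicalSpace Y] [R1Space Y]
    {S : Set Y} {a : Y} (hS : S ⊆ closure {a}) : IsCompact S := by
  intro l hl hlS
  obtain ⟨b, hb⟩ : S.Nonempty := by
    by_contra! h
    rw [h, Filter.principal_empty, le_bot_iff] at hlS
    exact hl.ne hlS
  have hle : l ≤ 𝓝 b := by
    refine hlS.trans fun U hU y hy => ?_
    have h1 : Inseparable a y := (specializes_iff_mem_closure.2 (hS hy)).inseparable
    have h2 : Inseparable a b := (specializes_iff_mem_closure.2 (hS hb)).inseparable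
    have h3 : 𝓝 y = 𝓝 b := h1.symm.trans h2
    rw [← h3] at hU
    exact mem_of_mem_nhds hU
  exact ⟨b, hb, by rw [ClusterPt, inf_eq_right.2 hle]; exact hl⟩

theorem exists_compact_of_le (hreg : IsCompactlyRegular f) {K : Set (LCLimit f)} (hK : IsCompact K)
    (n : ι) : ∃ k, n ≤ k ∧ ∃ C : Set (G k), IsCompact C ∧ of f k '' C = K := by
  obtain ⟨k, C, hC, hCK⟩ := hreg K hK
  refine ⟨max k n, le_max_right _ _, _, hC.image (f k _ (le_max_left k n)).continuous, ?_⟩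
  rw [← hCK, Set.image_image]
  simp only [of_map]

/-- If x ≠ 0 lies in the closure of 0, its irrational multiples form a compact set, the image of
some compact C in G k. The parameters t for which the multiple enters the image of C at step l form
a closed set, as G l is Hausdorff. Equality in the limit is detected at some step, so these
countably many closed sets cover exactly the irrationals. -/
theorem t2Space_of_isCompactlyRegular [∀ k, T2Space (G k)] [∀ k, ContinuousSMul 𝕜 (G k)]
    [Nonempty ι] [Countable ι]
    (hself : ∀ k x, f k k le_rfl x = x)
    (hmap : ∀ k l m (hkl : k ≤ l) (hlm : l ≤ m) x, f l m hlm (f k l hkl x) = f k m (hkl.trans hlm) x)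
    (hreg : IsCompactlyRegular f) : T2Space (LCLimit f) := by
  suffices h : ∀ x ∈ closure ({0} : Set (LCLimit f)), x = 0 by
    have h0 : IsClosed ({0} : Set (LCLimit f)) :=
      isClosed_of_closure_subset fun x hx => h x hx
    have := IsTopologicalAddGroup.t1Space (LCLimit f) h0
    infer_instance
  intro x hx
  by_contra hx0
  obtain ⟨n, c₀, rfl⟩ := exists_of f x
  let S : Set (LCLimit f) := {y | ∃ t : ℝ, Irrational t ∧ (t : 𝕜) • of f n c₀ = y}
  have hS : S ⊆ closure {0} := by
    rintro _ ⟨t, -, rfl⟩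
    have h2 := image_closure_subset_closure_image (continuous_const_smul (t : 𝕜) (T := LCLimit f))
      (Set.mem_image_of_mem _ hx)
    simpa using h2
  obtain ⟨k, hnk, C, hC, hCS⟩ :=
    exists_compact_of_le hreg (isCompact_of_subset_closure_singleton hS) n
  let T : {l // k ≤ l} → Set ℝ := fun l =>
    {t | (t : 𝕜) • f k l l.2 (f n k hnk c₀) ∈ f k l l.2 '' C}
  refine not_iUnion_isClosed_eq_irrational T (fun l => ?_) ?_
  · exact (hC.image (f k l l.2).continuous).isClosed.preimage
      (RCLike.continuous_ofReal.smul continuous_const)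
  · ext t
    simp only [Set.mem_iUnion, Set.mem_ofPred_eq]
    constructor
    · rintro ⟨l, z, hz, hzt⟩
      have h1 : of f k z ∈ S := hCS ▸ Set.mem_image_of_mem _ hz
      obtain ⟨s, hs, hsz⟩ := h1
      have h2 := congrArg (of f l) hzt
      rw [map_smul, of_map, of_map, of_map, ← hsz] at h2
      have h3 : (s : 𝕜) = t := smul_left_injective 𝕜 hx0 h2
      rwa [← RCLike.ofReal_inj.1 h3]
    · intro ht
      have h1 : (t : 𝕜) • of f n c₀ ∈ of f k '' C := hCS ▸ ⟨t, ht, rfl⟩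
      obtain ⟨z, hz, hzt⟩ := h1
      obtain ⟨l, hl, h2⟩ := exists_map_eq_zero hself hmap
        (x := z - (t : 𝕜) • f n k hnk c₀) (by rw [map_sub, hzt, map_smul, of_map, sub_self])
      rw [map_sub, map_smul, sub_eq_zero] at h2
      exact ⟨⟨l, hl⟩, z, hz, h2⟩

end Hausdorff

/-! ### Stabilisation of kernels -/

section Kernel

variable [∀ k, UniformSpace (G k)] {f : ∀ k l, k ≤ l → G k →L[𝕜] G l}
  [∀ k, IsUniformAddGroup (G k)] [∀ k, T2Space (G k)] [∀ k, FirstCountableTopology (G k)]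
  [∀ k, CompleteSpace (G k)] [∀ k, ContinuousSMul 𝕜 (G k)] [Nonempty ι] [Countable ι]

/-- In a Hausdorff limit the kernel of the canonical map is closed, hence a Baire space, and it is
the countable union of the closed kernels of the linking maps. One of these has interior, so it is
the whole kernel. -/
theorem exists_ker_le (hself : ∀ k x, f k k le_rfl x = x)
    (hmap : ∀ k l m (hkl : k ≤ l) (hlm : l ≤ m) x, f l m hlm (f k l hkl x) = f k m (hkl.trans hlm) x)
    [T2Space (LCLimit f)] (k : ι) :
    ∃ m, ∃ h : k ≤ m, ∀ x, of f k x = 0 → f k m h x = 0 := by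
  let N : Submodule 𝕜 (G k) := LinearMap.ker (of f k : G k →ₗ[𝕜] LCLimit f)
  have hN : IsClosed (N : Set (G k)) := (of f k).isClosed_ker
  have : CompleteSpace N := hN.completeSpace_coe
  have : (uniformity (G k)).IsCountablyGenerated :=
    IsUniformAddGroup.uniformity_countably_generated
  have : (uniformity N).IsCountablyGenerated := by
    rw [uniformity_subtype]
    infer_instance
  let S : {l // k ≤ l} → Submodule 𝕜 N := fun l =>
    LinearMap.ker ((f k l l.2 : G k →ₗ[𝕜] G l) ∘ₗ N.subtype)
  have hScl : ∀ l, IsClosed (S l : Set N) := fun l =>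
    isClosed_singleton.preimage ((f k l l.2).continuous.comp continuous_subtype_val)
  have hSU : ⋃ l, (S l : Set N) = Set.univ := by
    refine Set.eq_univ_of_forall fun x => ?_
    obtain ⟨l, hl, h⟩ := exists_map_eq_zero hself hmap (x := x.1) x.2
    exact Set.mem_iUnion.2 ⟨⟨l, hl⟩, h⟩
  obtain ⟨l, hl⟩ := nonempty_interior_of_iUnion_of_closed hScl hSU
  have htop := (S l).eq_top_of_nonempty_interior' hl
  refine ⟨l, l.2, fun x hx => ?_⟩
  have : (⟨x, hx⟩ : N) ∈ S l := htop ▸ Submodule.mem_top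
  exact this

end Kernel

end LCLimit

/-! ### Compact regularity implies acyclicity -/

namespace LCLimit

variable {𝕜 : Type*} [RCLike 𝕜] {ι : Type*} [LinearOrder ι] {G : ι → Type*}
  [∀ k, AddCommGroup (G k)] [∀ k, Module 𝕜 (G k)]
  [∀ k, UniformSpace (G k)] {f : ∀ k l, k ≤ l → G k →L[𝕜] G l}
  [∀ k, IsUniformAddGroup (G k)] [∀ k, T2Space (G k)] [∀ k, FirstCountableTopology (G k)]
  [∀ k, CompleteSpace (G k)] [∀ k, PolynormableSpace 𝕜 (G k)] [Nonempty ι] [Countable ι]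

omit [Countable ι] [Nonempty ι] [∀ k, IsUniformAddGroup (G k)] [∀ k, T2Space (G k)]
  [∀ k, FirstCountableTopology (G k)] [∀ k, CompleteSpace (G k)]
  [∀ k, PolynormableSpace 𝕜 (G k)] in
-- A continuous seminorm of the limit, pulled back to G k, is dominated by some P n₀; this handles
-- all rows n > n₀. Each of the finitely many remaining rows is a null sequence already in a later
-- step.
theorem tendsto_of_cofinite {k : ι} {l : ℕ → ι} {h : ∀ n, k ≤ l n} {y : ℕ → ℕ → G k}
    {P : ℕ → Seminorm 𝕜 (G k)} (hPm : Monotone P)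
    (hP : ∀ p : Seminorm 𝕜 (G k), Continuous p → ∃ n, p ≤ P n)
    (hy : ∀ n i, P n (y n i) ≤ 1 / (n + 1))
    (hy0 : ∀ n, Filter.Tendsto (fun i => f k (l n) (h n) (y n i)) Filter.atTop (𝓝 0)) :
    Filter.Tendsto (fun a : ℕ × ℕ => of f k (y a.1 a.2)) Filter.cofinite (𝓝 0) := by
  intro V hV
  obtain ⟨w, hw, hwV⟩ := PolynormableSpace.exists_seminorm_lt_one_subset 𝕜 hV
  obtain ⟨n₀, hn₀⟩ := hP _ (Seminorm.continuous_comp_clm hw (of f k))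
  have hi : ∀ n, ∃ I, ∀ i, I ≤ i → w (of f k (y n i)) < 1 := by
    intro n
    have h1 : Filter.Tendsto (fun i => w (of f (l n) (f k (l n) (h n) (y n i)))) Filter.atTop
        (𝓝 0) := by
      have h2 : Continuous fun x => w (of f (l n) x) := hw.comp (of f (l n)).continuous
      simpa [Function.comp_def] using (h2.tendsto 0).comp (hy0 n)
    obtain ⟨I, hI⟩ := Filter.eventually_atTop.1 (h1.eventually_lt_const one_pos)
    exact ⟨I, fun i hi => by simpa only [of_map] using hI i hi⟩
  choose I hI using hi
  refine Filter.mem_map.2 (Filter.mem_cofinite.2 (Set.Finite.subset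
    (Finset.finite_toSet (Finset.range (n₀ + 1) ×ˢ
      Finset.range ((Finset.range (n₀ + 1)).sup I))) ?_))
  rintro ⟨n, i⟩ hni
  have hni' : ¬ w (of f k (y n i)) < 1 := fun hlt => hni (hwV _ hlt)
  have hn : n < n₀ + 1 := by
    by_contra! hn
    refine hni' ((hn₀ _).trans_lt (((hPm (show n₀ ≤ n by omega)) _).trans_lt
      ((hy n i).trans_lt ?_)))
    have : (1 : ℝ) ≤ n := by exact_mod_cast (show 1 ≤ n by omega)
    rw [div_lt_one (by positivity)]
    linarith
  have hiI : i < I n := by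
    by_contra! h
    exact hni' (hI n i h)
  simpa using ⟨Nat.lt_succ_iff.1 hn, n, Nat.lt_succ_iff.1 hn, hiI⟩

/-- In a compactly regular inductive limit of Fréchet spaces, for each `k` there are `m ≥ k` and a
neighbourhood of zero in `G k` on which the topologies of `G m` and `G l` agree for all `l ≥ m`. -/
theorem exists_acyclic_step (hself : ∀ k x, f k k le_rfl x = x)
    (hmap : ∀ k l m (hkl : k ≤ l) (hlm : l ≤ m) x, f l m hlm (f k l hkl x) = f k m (hkl.trans hlm) x)
    (hreg : IsCompactlyRegular f) (k : ι) :
    ∃ m, ∃ hkm : k ≤ m, ∃ p : Seminorm 𝕜 (G k), Continuous p ∧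
      ∀ l (hl : m ≤ l) (r : Seminorm 𝕜 (G m)), Continuous r → ∀ ε : ℝ, 0 < ε →
        ∃ q : Seminorm 𝕜 (G l), Continuous q ∧
          ∀ x, r (f k m hkm x) ≤ ε * p x + q (f k l (hkm.trans hl) x) := by
  have hsmul : ∀ k, ContinuousSMul 𝕜 (G k) := fun k =>
    (PolynormableSpace.withSeminorms 𝕜 (G k)).continuousSMul
  have hT2 := t2Space_of_isCompactlyRegular hself hmap hreg
  choose κ hκ hker using exists_ker_le hself hmap
  obtain ⟨e, he⟩ := exists_surjective_nat ι
  obtain ⟨P, hPm, hPc, hP⟩ := PolynormableSpace.exists_seq_seminorm 𝕜 (G k)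
  by_contra! hcon
  -- Beyond this index the kernel of the map from G (max k (e n)) to the limit is already reached.
  -- Negating the claim with m n and P n produces l n, r n and ε n.
  let m : ℕ → ι := fun n => κ (max k (e n))
  have hkm : ∀ n, k ≤ m n := fun n => (le_max_left k (e n)).trans (hκ _)
  choose l hl r hr ε hε hx using fun n => hcon (m n) (hkm n) (P n) (hPc n)
  have hyn : ∀ n, ∃ y : ℕ → G k, (∀ i, P n (y i) ≤ 1 / (n + 1)) ∧
      Filter.Tendsto (fun i => f k (l n) ((hkm n).trans (hl n)) (y i)) Filter.atTop (𝓝 0) ∧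
      ∀ i, r n (f k (m n) (hkm n) (y i)) = ε n / (n + 1) := by
    intro n
    obtain ⟨Q, hQm, hQc, hQ⟩ := PolynormableSpace.exists_seq_seminorm 𝕜 (G (l n))
    -- Rescaling a counterexample so that r n takes the fixed value ε n / (n + 1) bounds P n by 1 /
    -- (n + 1). The factor i + 1 makes the row tend to 0 in G (l n).
    have hyi : ∀ i : ℕ, ∃ y, P n y ≤ 1 / (n + 1) ∧
        (i + 1) * Q i (f k (l n) ((hkm n).trans (hl n)) y) ≤ ε n / (n + 1) ∧
        r n (f k (m n) (hkm n) y) = ε n / (n + 1) := by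
      intro i
      obtain ⟨q, hq, hqe⟩ := Seminorm.exists_continuous_const_mul (hQc i)
        (show (0 : ℝ) ≤ i + 1 by positivity)
      obtain ⟨x, hx⟩ := hx n q hq
      rw [hqe] at hx
      have h1 : 0 ≤ ε n * P n x := mul_nonneg (hε n).le (apply_nonneg _ _)
      have h2 : 0 ≤ (i + 1) * Q i (f k (l n) ((hkm n).trans (hl n)) x) :=
        mul_nonneg (by positivity) (apply_nonneg _ _)
      set R := r n (f k (m n) (hkm n) x) with hR
      have hR0 : 0 < R := by linarith
      have hεn := hε n
      have ha0 : 0 < ε n / (n + 1) / R := by positivity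
      have hn : ‖((ε n / (n + 1) / R : ℝ) : 𝕜)‖ = ε n / (n + 1) / R := by
        rw [RCLike.norm_ofReal, abs_of_pos ha0]
      refine ⟨((ε n / (n + 1) / R : ℝ) : 𝕜) • x, ?_, ?_, ?_⟩
      · rw [map_smul_eq_mul, hn, div_div, div_mul_eq_mul_div, div_le_div_iff₀ (by positivity)
          (by positivity)]
        nlinarith [show (0 : ℝ) < (n : ℝ) + 1 by positivity]
      · rw [map_smul, map_smul_eq_mul, hn, mul_left_comm]
        refine (mul_le_mul_of_nonneg_left (show _ ≤ R by linarith) ha0.le).trans ?_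
        rw [div_mul_cancel₀ _ hR0.ne']
      · rw [map_smul, map_smul_eq_mul, hn, ← hR, div_mul_cancel₀ _ hR0.ne']
    choose y hy1 hy2 hy3 using hyi
    refine ⟨y, hy1, ?_, hy3⟩
    intro V hV
    obtain ⟨w, hw, hwV⟩ := PolynormableSpace.exists_seminorm_lt_one_subset 𝕜 hV
    obtain ⟨i₀, hi₀⟩ := hQ w hw
    obtain ⟨i₁, hi₁⟩ := exists_nat_gt (ε n / (n + 1))
    refine Filter.mem_map.2 (Filter.mem_atTop_sets.2 ⟨max i₀ i₁, fun i hi => hwV _ ?_⟩)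
    refine (hi₀ _).trans_lt ((hQm ((le_max_left _ _).trans hi) _).trans_lt ?_)
    have h1 := hy2 i
    have h2 : (i₁ : ℝ) ≤ i := by exact_mod_cast (le_max_right _ _).trans hi
    by_contra! h3
    nlinarith [show (0 : ℝ) < (i : ℝ) + 1 by positivity]
  choose y hyP hy0 hyr using hyn
  -- Regularity places this compact set in some step e n; the contradiction comes from row n alone.
  have hK := (tendsto_of_cofinite hPm hP hyP hy0).isCompact_insert_range_of_cofinite
  obtain ⟨m', C, hC, hCK⟩ := hreg _ hK
  obtain ⟨n, rfl⟩ := he m'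
  -- Points of C and y n i with the same image in the limit become equal in G (m n), since the
  -- kernel has stabilised there.
  have hCz : ∀ i, ∃ c ∈ C, f (e n) (m n) ((le_max_right k (e n)).trans (hκ _)) c =
      f k (m n) (hkm n) (y n i) := by
    intro i
    have h1 : of f k (y n i) ∈ of f (e n) '' C := hCK ▸ Or.inr ⟨(n, i), rfl⟩
    obtain ⟨c, hc, hcy⟩ := h1
    refine ⟨c, hc, ?_⟩
    have h2 := hker (max k (e n)) (f (e n) _ (le_max_right k (e n)) c -
      f k _ (le_max_left k (e n)) (y n i)) (by rw [map_sub, of_map, of_map, hcy, sub_self])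
    rw [map_sub, hmap, hmap, sub_eq_zero] at h2
    exact h2
  obtain ⟨z, ⟨c, hc, rfl⟩, hz⟩ := (hC.image
    (f (e n) (m n) ((le_max_right k (e n)).trans (hκ _))).continuous).exists_mapClusterPt
    (f := Filter.atTop) (u := fun i => f k (m n) (hkm n) (y n i))
    (Filter.le_principal_iff.2 (Filter.mem_map.2 (Filter.univ_mem' hCz)))
  -- A cluster point of the row in G (m n) maps to 0 in G (l n), where the row converges to 0.
  -- Kernel stabilisation makes the cluster point itself 0, against the constant positive value of r
  -- n along the row.
  have hz0 : f (m n) (l n) (hl n) (f (e n) (m n) ((le_max_right k (e n)).trans (hκ _)) c) = 0 := by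
    have h1 := hz.continuousAt_comp (f (m n) (l n) (hl n)).continuous.continuousAt
    have h2 : Filter.Tendsto ((f (m n) (l n) (hl n)) ∘ fun i => f k (m n) (hkm n) (y n i))
        Filter.atTop (𝓝 0) := by
      simpa only [Function.comp_def, hmap] using hy0 n
    have h3 := ClusterPt.mono h1 h2
    exact eq_of_nhds_neBot h3
  have hc0 : of f (e n) c = 0 := by
    rw [← of_map f _ (m n) ((le_max_right k (e n)).trans (hκ _)), ← of_map f _ _ (hl n), hz0,
      map_zero]
  have hc1 := hker (max k (e n)) (f (e n) _ (le_max_right k (e n)) c) (by rw [of_map, hc0])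
  rw [hmap] at hc1
  rw [hc1] at hz
  have hεn : 0 < ε n / (n + 1) := div_pos (hε n) (by positivity)
  have hev : ∀ᶠ x in 𝓝 (0 : G (m n)), r n x < ε n / (n + 1) :=
    (hr n).continuousAt.eventually_lt_const (by simpa using hεn)
  obtain ⟨i, hi⟩ := (hz.frequently hev).exists
  exact hi.ne (hyr n i)

end LCLimit

/-! ### Completeness of compactly regular limits -/

namespace LCLimit

variable {𝕜 : Type*} [RCLike 𝕜] {ι : Type*} [LinearOrder ι] {G : ι → Type*}
  [∀ k, AddCommGroup (G k)] [∀ k, Module 𝕜 (G k)]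
  [∀ k, UniformSpace (G k)] {f : ∀ k l, k ≤ l → G k →L[𝕜] G l}
  [∀ k, IsUniformAddGroup (G k)] [∀ k, T2Space (G k)] [∀ k, FirstCountableTopology (G k)]
  [∀ k, CompleteSpace (G k)] [∀ k, PolynormableSpace 𝕜 (G k)] [Nonempty ι] [Countable ι]

omit [∀ k, T2Space (G k)] [∀ k, FirstCountableTopology (G k)] [∀ k, CompleteSpace (G k)]
  [∀ k, PolynormableSpace 𝕜 (G k)] [Countable ι] in
theorem isSeqLimit_of_cofinal (hself : ∀ k x, f k k le_rfl x = x)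
    (hmap : ∀ k l m (hkl : k ≤ l) (hlm : l ≤ m) x, f l m hlm (f k l hkl x) = f k m (hkl.trans hlm) x)
    {φ : ℕ → ι} (hφ : Monotone φ) (hcof : ∀ k, ∃ n, k ≤ φ n) :
    IsSeqLimit (fun m n h => f (φ m) (φ n) (hφ h)) (fun n => of f (φ n)) where
  map_self n x := hself _ x
  map_map l m n hlm hmn x := hmap _ _ _ _ _ x
  apply_map m n h x := of_map f _ _ _ x
  exists_eq y := by
    obtain ⟨k, x, rfl⟩ := exists_of f y
    obtain ⟨n, hn⟩ := hcof k
    exact ⟨n, f k _ hn x, of_map f _ _ _ x⟩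
  exists_map_eq_zero n x hx := by
    obtain ⟨l, hl, h⟩ := exists_map_eq_zero hself hmap hx
    obtain ⟨m, hm⟩ := hcof l
    refine ⟨max n m, le_max_left n m, ?_⟩
    have hlm : l ≤ φ (max n m) := hm.trans (hφ (le_max_right n m))
    rw [← hmap _ l _ hl hlm, h, map_zero]
  seminorm_continuous P hP := seminorm_continuous f P fun k => by
    obtain ⟨n, hn⟩ := hcof k
    have h1 : Continuous fun x => P (of f (φ n) (f k (φ n) hn x)) :=
      (hP n).comp (f k (φ n) hn).continuous
    simp only [of_map] at h1
    exact h1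

/-- A compactly regular countable inductive limit of Fréchet spaces is complete. -/
theorem exists_limit (hself : ∀ k x, f k k le_rfl x = x)
    (hmap : ∀ k l m (hkl : k ≤ l) (hlm : l ≤ m) x, f l m hlm (f k l hkl x) = f k m (hkl.trans hlm) x)
    (hreg : IsCompactlyRegular f) {𝓕 : Filter (LCLimit f)} [𝓕.NeBot]
    (h𝓕 : ∀ w : Seminorm 𝕜 (LCLimit f), Continuous w → ∃ F ∈ 𝓕, ∀ x ∈ F, ∀ y ∈ F, w (x - y) < 1) :
    ∃ x, ∀ w : Seminorm 𝕜 (LCLimit f), Continuous w → ∀ᶠ y in 𝓕, w (y - x) < 1 := by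
  choose M hM p hp hq using exists_acyclic_step hself hmap hreg
  obtain ⟨e, he⟩ := exists_surjective_nat ι
  -- The maximum with M (φ n) passes the acyclic index, and that with e n makes φ cofinal.
  let φ : ℕ → ι := fun n => Nat.rec (e 0) (fun n k => max (M k) (e n)) n
  have hφs : ∀ n, φ (n + 1) = max (M (φ n)) (e n) := fun n => rfl
  have hMφ : ∀ n, M (φ n) ≤ φ (n + 1) := fun n => le_max_left _ _
  have hφ : Monotone φ := monotone_nat_of_le_succ fun n => (hM _).trans (hMφ n)
  have hcof : ∀ k, ∃ n, k ≤ φ n := fun k => by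
    obtain ⟨n, rfl⟩ := he k
    exact ⟨n + 1, le_max_right _ _⟩
  refine (isSeqLimit_of_cofinal hself hmap hφ hcof).exists_limit (p := fun n => p (φ n))
    ⟨fun n => hp _, fun n r hr ε hε => ?_⟩ h𝓕
  obtain ⟨q, hqc, hqle⟩ := hq (φ n) (φ (n + 2)) ((hMφ n).trans (hφ (Nat.le_succ (n + 1))))
    (r.comp (f (M (φ n)) (φ (n + 1)) (hMφ n) : G (M (φ n)) →ₗ[𝕜] _))
    (Seminorm.continuous_comp_clm hr _) ε hε
  refine ⟨q, hqc, fun x => ?_⟩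
  have h1 := hqle x
  rw [Seminorm.comp_apply, ContinuousLinearMap.coe_coe, hmap] at h1
  exact h1

theorem completeSpace_of_isCompactlyRegular (hself : ∀ k x, f k k le_rfl x = x)
    (hmap : ∀ k l m (hkl : k ≤ l) (hlm : l ≤ m) x, f l m hlm (f k l hkl x) = f k m (hkl.trans hlm) x)
    (hreg : IsCompactlyRegular f) :
    @CompleteSpace (LCLimit f) (IsTopologicalAddGroup.rightUniformSpace _) := by
  let _ : UniformSpace (LCLimit f) := IsTopologicalAddGroup.rightUniformSpace _
  have : IsUniformAddGroup (LCLimit f) := isUniformAddGroup_of_addCommGroup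
  refine ⟨fun {𝓕} h𝓕 => ?_⟩
  have := h𝓕.1
  obtain ⟨x, hx⟩ := exists_limit hself hmap hreg (𝓕 := 𝓕) (by
    intro w hw
    have h1 : {a : LCLimit f × LCLimit f | w (a.2 - a.1) < 1} ∈ uniformity (LCLimit f) := by
      rw [uniformity_eq_comap_nhds_zero]
      exact Filter.preimage_mem_comap (Seminorm.lt_one_mem_nhds hw)
    obtain ⟨F, hF, hFw⟩ := Filter.mem_prod_same_iff.1 (h𝓕.2 h1)
    exact ⟨F, hF, fun x hx y hy => hFw (Set.mk_mem_prod hy hx)⟩)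
  refine ⟨x, fun V hV => ?_⟩
  have h1 : (fun y => x + y) ⁻¹' V ∈ 𝓝 (0 : LCLimit f) :=
    (continuous_const_add x).continuousAt.preimage_mem_nhds (by simpa using hV)
  obtain ⟨w, hw, hwV⟩ := PolynormableSpace.exists_seminorm_lt_one_subset 𝕜 h1
  filter_upwards [hx w hw] with y hy
  simpa using hwV _ hy

end LCLimit

/-! ### Completions and inductive tensor products of Fréchet spaces -/

/-- A continuous seminorm extends to the completion. By density, the open unit ball of the extension
lies in the closure of that of the original, hence in any closed neighbourhood containing the
latter. -/
theorem PolynormableSpace.completion {𝕜 Y : Type*} [RCLike 𝕜] [AddCommGroup Y] [Module 𝕜 Y]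
    [UniformSpace Y] [IsUniformAddGroup Y] [UniformContinuousConstSMul 𝕜 Y]
    [PolynormableSpace 𝕜 Y] : PolynormableSpace 𝕜 (Completion Y) := by
  refine .of_exists_seminorm fun V hV => ?_
  obtain ⟨W, hW, hWc, hWV⟩ := exists_mem_nhds_isClosed_subset hV
  have h1 : (fun y : Y => (y : Completion Y)) ⁻¹' W ∈ 𝓝 (0 : Y) :=
    (Completion.continuous_coe Y).continuousAt.preimage_mem_nhds (by simpa only [Completion.coe_zero] using hW)
  obtain ⟨p, hp, hpW⟩ := PolynormableSpace.exists_seminorm_lt_one_subset 𝕜 h1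
  have hpu : UniformContinuous p := Seminorm.uniformContinuous_of_continuousAt_zero hp.continuousAt
  let P : Completion Y → ℝ := Completion.extension p
  have hPc : Continuous P := Completion.continuous_extension
  have hPe : ∀ y : Y, P y = p y := fun y => Completion.extension_coe hpu y
  let P' : Seminorm 𝕜 (Completion Y) := Seminorm.of P
    (fun x y => by
      induction x, y using Completion.induction_on₂ with
      | hp => exact isClosed_le (by fun_prop) (by fun_prop)
      | ih x y =>
        rw [← Completion.coe_add, hPe, hPe, hPe]
        exact map_add_le_add p x y)
    (fun a x => by
      induction x using Completion.induction_on with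
      | hp => exact isClosed_eq (hPc.comp (continuous_const_smul a)) (by fun_prop)
      | ih x => rw [← Completion.coe_smul, hPe, hPe, map_smul_eq_mul])
  refine ⟨P', hPc, fun x hx => hWV ?_⟩
  have hdense := Completion.denseRange_coe (α := Y)
  have h2 := hdense.open_subset_closure_inter (isOpen_lt hPc (continuous_const (y := (1 : ℝ))))
  refine closure_minimal ?_ hWc (h2 hx)
  rintro _ ⟨hy, y, rfl⟩
  exact hpW y (by rwa [← hPe])

theorem isCountablyGenerated_uniformity_completion {Y : Type*} [AddCommGroup Y] [UniformSpace Y]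
    [IsUniformAddGroup Y] (h : (𝓝 (0 : Y)).IsCountablyGenerated) :
    (uniformity (Completion Y)).IsCountablyGenerated := by
  obtain ⟨V, hV⟩ := (𝓝 (0 : Y)).exists_antitone_basis
  have h1 := hV.1.hasBasis_of_isDenseInducing Completion.isDenseInducing_coe
  rw [Completion.coe_zero] at h1
  have := h1.isCountablyGenerated
  exact IsUniformAddGroup.uniformity_countably_generated

namespace InductiveTensor

variable {𝕜 E F : Type*} [RCLike 𝕜] [AddCommGroup E] [Module 𝕜 E] [AddCommGroup F] [Module 𝕜 F]

theorem tmul_add (x : E) (y y' : F) : tmul 𝕜 x (y + y') = tmul 𝕜 x y + tmul 𝕜 x y' :=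
  TensorProduct.tmul_add _ _ _

theorem add_tmul (x x' : E) (y : F) : tmul 𝕜 (x + x') y = tmul 𝕜 x y + tmul 𝕜 x' y :=
  TensorProduct.add_tmul _ _ _

theorem tmul_smul (a : 𝕜) (x : E) (y : F) : tmul 𝕜 x (a • y) = a • tmul 𝕜 x y :=
  TensorProduct.tmul_smul _ _ _

theorem smul_tmul (a : 𝕜) (x : E) (y : F) : tmul 𝕜 (a • x) y = a • tmul 𝕜 x y :=
  (TensorProduct.smul_tmul' _ _ _).symm

theorem induction_on {p : InductiveTensor 𝕜 E F → Prop} (z : InductiveTensor 𝕜 E F) (h0 : p 0)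
    (ht : ∀ x y, p (tmul 𝕜 x y)) (ha : ∀ z z', p z → p z' → p (z + z')) : p z :=
  TensorProduct.induction_on z h0 ht ha

/-- The linear map `y ↦ x ⊗ y`. -/
def mkLeft (x : E) : F →ₗ[𝕜] InductiveTensor 𝕜 E F where
  toFun := tmul 𝕜 x
  map_add' := tmul_add x
  map_smul' a y := tmul_smul a x y

/-- The linear map `x ↦ x ⊗ y`. -/
def mkRight (y : F) : E →ₗ[𝕜] InductiveTensor 𝕜 E F where
  toFun x := tmul 𝕜 x y
  map_add' x x' := add_tmul x x' y
  map_smul' a x := smul_tmul a x y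

variable [TopologicalSpace E] [TopologicalSpace F]

theorem continuous_tmul_left (x : E) : Continuous fun y : F => tmul 𝕜 x y :=
  continuous_sInf_rng.2 fun _ ht => ht.2.1 x

theorem continuous_tmul_right (y : F) : Continuous fun x : E => tmul 𝕜 x y :=
  continuous_sInf_rng.2 fun _ ht => ht.2.2 y

theorem seminorm_continuous [IsTopologicalAddGroup E] [IsTopologicalAddGroup F]
    (P : Seminorm 𝕜 (InductiveTensor 𝕜 E F)) (hl : ∀ x, Continuous fun y => P (tmul 𝕜 x y))
    (hr : ∀ y, Continuous fun x => P (tmul 𝕜 x y)) : Continuous P := by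
  have hle : sInf {t : TopologicalSpace (InductiveTensor 𝕜 E F) |
      PolynormableSpace 𝕜 (InductiveTensor 𝕜 E F) (topology := t) ∧
      (∀ x : E, Continuous[inferInstance, t] fun y : F => tmul 𝕜 x y) ∧
      (∀ y : F, Continuous[inferInstance, t] fun x : E => tmul 𝕜 x y)} ≤ P.topology :=
    sInf_le ⟨P.polynormableSpace_topology,
      fun x => P.continuous_to_topology (mkLeft x) (hl x),
      fun y => P.continuous_to_topology (mkRight y) (hr y)⟩
  exact continuous_le_dom hle P.continuous_topology

theorem continuous_linearMap [IsTopologicalAddGroup E] [IsTopologicalAddGroup F] {Y : Type*}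
    [AddCommGroup Y] [Module 𝕜 Y] [TopologicalSpace Y] [PolynormableSpace 𝕜 Y]
    (T : InductiveTensor 𝕜 E F →ₗ[𝕜] Y) (hl : ∀ x, Continuous fun y => T (tmul 𝕜 x y))
    (hr : ∀ y, Continuous fun x => T (tmul 𝕜 x y)) : Continuous T :=
  continuous_of_seminorm T fun _ hp =>
    seminorm_continuous _ (fun x => hp.comp (hl x)) fun y => hp.comp (hr y)

end InductiveTensor

namespace InductiveTensor

variable {𝕜 E F : Type*} [RCLike 𝕜] [AddCommGroup E] [Module 𝕜 E] [AddCommGroup F] [Module 𝕜 F]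
  [TopologicalSpace E] [TopologicalSpace F]

/-- For `E` with a cofinal sequence `r` of seminorms, `F` barrelled with a cofinal sequence `q`,
every continuous seminorm on `E ⊗_ι F` is dominated by a product. -/
theorem exists_le_mul [IsTopologicalAddGroup E] [PolynormableSpace 𝕜 E] [BarrelledSpace 𝕜 F]
    {r : ℕ → Seminorm 𝕜 E} (hrm : Monotone r)
    (hr : ∀ p : Seminorm 𝕜 E, Continuous p → ∃ n, p ≤ r n) {q : ℕ → Seminorm 𝕜 F}
    (hq : ∀ p : Seminorm 𝕜 F, Continuous p → ∃ n, p ≤ q n)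
    {s : Seminorm 𝕜 (InductiveTensor 𝕜 E F)} (hs : Continuous s) :
    ∃ n, ∀ x y, s (tmul 𝕜 x y) ≤ r n x * q n y := by
  obtain ⟨n, hn⟩ : ∃ n, ∀ x y, r n x < 1 → q n y < 1 → s (tmul 𝕜 x y) < 1 := by
    by_contra! hcon
    choose x y hx hy hxy using hcon
    have hx0 : Filter.Tendsto x Filter.atTop (𝓝 0) := by
      intro V hV
      obtain ⟨p, hp, hpV⟩ := PolynormableSpace.exists_seminorm_lt_one_subset 𝕜 hV
      obtain ⟨m, hm⟩ := hr p hp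
      refine Filter.mem_map.2 (Filter.mem_atTop_sets.2 ⟨m, fun k hk => hpV _ ?_⟩)
      exact (hm _).trans_lt ((hrm hk _).trans_lt (hx k))
    -- Banach–Steinhaus: as x k → 0, the seminorms s(x k ⊗ ·) are pointwise bounded, so their
    -- supremum is continuous on the barrelled space F and lies below some q m. This contradicts the
    -- choice of y m.
    let σ : ℕ → Seminorm 𝕜 F := fun k => s.comp (mkLeft (x k))
    have hσ : ∀ k, Continuous (σ k) := fun k => hs.comp (continuous_tmul_left (x k))
    have hbdd : BddAbove (Set.range σ) := by
      rw [Seminorm.bddAbove_range_iff]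
      intro z
      have h1 : Continuous fun a => s (tmul 𝕜 a z) := hs.comp (continuous_tmul_right z)
      exact ((h1.tendsto 0).comp hx0).bddAbove_range
    have hc : Continuous (⨆ k, σ k : Seminorm 𝕜 F) := by
      rw [Seminorm.coe_iSup_eq hbdd]
      exact Seminorm.continuous_iSup σ hσ hbdd
    obtain ⟨m, hm⟩ := hq _ hc
    have h1 : s (tmul 𝕜 (x m) (y m)) ≤ (⨆ k, σ k) (y m) := le_ciSup hbdd m (y m)
    exact (h1.trans ((hm _))).not_gt ((hy m).trans_le (hxy m))
  refine ⟨n, fun x y => ?_⟩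
  -- Homogeneity in each variable turns the implication between unit balls into the product bound;
  -- working with t > q n y avoids dividing by q n y = 0.
  have h1 : ∀ y, q n y < 1 → ∀ x, s (tmul 𝕜 x y) ≤ r n x := fun y hy =>
    Seminorm.le_of_lt_one_imp (p := s.comp (mkRight y)) fun x hx => hn x y hx hy
  have h2 : ∀ t, q n y < t → s (tmul 𝕜 x y) ≤ r n x * t := by
    intro t ht
    have ht0 : 0 < t := (apply_nonneg (q n) y).trans_lt ht
    have htn : ‖((t : 𝕜))⁻¹‖ = t⁻¹ := by simp [abs_of_pos ht0]
    have h3 := h1 ((t : 𝕜)⁻¹ • y) (by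
      rw [map_smul_eq_mul, htn, inv_mul_lt_iff₀ ht0]; linarith) x
    rw [tmul_smul, map_smul_eq_mul, htn, inv_mul_le_iff₀ ht0] at h3
    linarith
  refine le_of_forall_pos_le_add fun ε hε => ?_
  have hr0 := apply_nonneg (r n) x
  have h3 := h2 (q n y + ε / (r n x + 1)) (by
    have : 0 < ε / (r n x + 1) := by positivity
    linarith)
  have h4 : r n x * (ε / (r n x + 1)) ≤ ε := by
    rw [mul_div_assoc', div_le_iff₀ (by positivity)]
    nlinarith
  linarith

/-- The largest seminorm π n dominated by r n ⊗ q n on elementary tensors is continuous, and by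
`exists_le_mul` the sequence π n is cofinal among the continuous seminorms. -/
theorem isCountablyGenerated_nhds_zero [IsTopologicalAddGroup E] [IsTopologicalAddGroup F]
    [PolynormableSpace 𝕜 E] [PolynormableSpace 𝕜 F] [FirstCountableTopology E]
    [FirstCountableTopology F] [BarrelledSpace 𝕜 F] :
    (𝓝 (0 : InductiveTensor 𝕜 E F)).IsCountablyGenerated := by
  obtain ⟨r, hrm, hrc, hr⟩ := PolynormableSpace.exists_seq_seminorm 𝕜 E
  obtain ⟨q, hqm, hqc, hq⟩ := PolynormableSpace.exists_seq_seminorm 𝕜 F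
  let S : ℕ → Set (Seminorm 𝕜 (InductiveTensor 𝕜 E F)) := fun n =>
    {s | ∀ x y, s (tmul 𝕜 x y) ≤ r n x * q n y}
  have hbdd : ∀ n, BddAbove (S n) := by
    intro n
    have hz : ∀ z : InductiveTensor 𝕜 E F, ∃ C, ∀ s ∈ S n, s z ≤ C := by
      intro z
      induction z using InductiveTensor.induction_on with
      | h0 => exact ⟨0, fun s _ => (map_zero s).le⟩
      | ht x y => exact ⟨_, fun s hs => hs x y⟩
      | ha z z' hz hz' =>
        obtain ⟨C, hC⟩ := hz
        obtain ⟨C', hC'⟩ := hz'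
        exact ⟨C + C', fun s hs =>
          (map_add_le_add s z z').trans (add_le_add (hC s hs) (hC' s hs))⟩
    choose C hC using hz
    exact Seminorm.bddAbove_iff.2 ⟨C, Set.forall_mem_image.2 fun s hs z => hC z s hs⟩
  let π : ℕ → Seminorm 𝕜 (InductiveTensor 𝕜 E F) := fun n => sSup (S n)
  have hπ : ∀ n x y, π n (tmul 𝕜 x y) ≤ r n x * q n y := by
    intro n x y
    rw [Seminorm.sSup_apply (hbdd n)]
    have h0 : (0 : Seminorm 𝕜 (InductiveTensor 𝕜 E F)) ∈ S n := fun x y =>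
      mul_nonneg (apply_nonneg _ _) (apply_nonneg _ _)
    have : Nonempty (S n) := ⟨⟨0, h0⟩⟩
    exact ciSup_le fun s => s.2 x y
  have hsmulE := (PolynormableSpace.withSeminorms 𝕜 E).continuousSMul
  have hsmulF := (PolynormableSpace.withSeminorms 𝕜 F).continuousSMul
  have hπc : ∀ n, Continuous (π n) := by
    intro n
    refine seminorm_continuous _ (fun x => ?_) fun y => ?_
    · obtain ⟨p, hp, hpe⟩ := Seminorm.exists_continuous_const_mul (hqc n) (apply_nonneg (r n) x)
      exact Seminorm.continuous_of_le (p := (π n).comp (mkLeft x)) hp fun y => by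
        rw [hpe]; exact hπ n x y
    · obtain ⟨p, hp, hpe⟩ := Seminorm.exists_continuous_const_mul (hrc n) (apply_nonneg (q n) y)
      exact Seminorm.continuous_of_le (p := (π n).comp (mkRight y)) hp fun x => by
        rw [hpe, mul_comm]; exact hπ n x y
  have hbasis : (𝓝 (0 : InductiveTensor 𝕜 E F)).HasBasis (fun _ : ℕ => True)
      fun n => {z | π n z < 1} := by
    refine ⟨fun V => ⟨fun hV => ?_, ?_⟩⟩
    · obtain ⟨s, hs, hsV⟩ := PolynormableSpace.exists_seminorm_lt_one_subset 𝕜 hV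
      obtain ⟨n, hn⟩ := exists_le_mul hrm hr hq hs
      exact ⟨n, trivial, fun z hz => hsV z ((le_csSup (hbdd n) hn z).trans_lt hz)⟩
    · rintro ⟨n, -, hn⟩
      exact Filter.mem_of_superset (Seminorm.lt_one_mem_nhds (hπc n)) hn
  exact hbasis.isCountablyGenerated

end InductiveTensor

theorem IsFrechetSpace.completedTensor (𝕜 E F : Type*) [RCLike 𝕜] [AddCommGroup E] [Module 𝕜 E]
    [AddCommGroup F] [Module 𝕜 F] [UniformSpace E] [UniformSpace F] [hE : IsFrechetSpace 𝕜 E]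
    [hF : IsFrechetSpace 𝕜 F] : IsFrechetSpace 𝕜 (CompletedTensor 𝕜 E F) := by
  have := hE.isUniformAddGroup
  have := hF.isUniformAddGroup
  have := hE.metrizable
  have := hF.metrizable
  have := hE.locallyConvex
  have := hF.locallyConvex
  have := hF.complete
  -- Together with completeness this makes F a Baire space, hence barrelled.
  have : (uniformity F).IsCountablyGenerated := IsUniformAddGroup.uniformity_countably_generated
  have := (PolynormableSpace.withSeminorms 𝕜 F).continuousSMul
  have hc := isCountablyGenerated_uniformity_completion
    (InductiveTensor.isCountablyGenerated_nhds_zero (𝕜 := 𝕜) (E := E) (F := F))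
  exact ⟨inferInstance, PolynormableSpace.completion, UniformSpace.metrizableSpace, inferInstance⟩

/-! ### Elementary tensors and the two comparison maps -/

namespace CompletedTensor

variable {𝕜 E E' F : Type*} [RCLike 𝕜] [AddCommGroup E] [Module 𝕜 E]
  [AddCommGroup E'] [Module 𝕜 E'] [AddCommGroup F] [Module 𝕜 F]
  [TopologicalSpace E] [TopologicalSpace E'] [TopologicalSpace F]

theorem map_tmul (g : E →L[𝕜] E') (x : E) (y : F) :
    map F g (tmul 𝕜 x y) = tmul 𝕜 (g x) y :=
  (InductiveTensor.map F g).completion_apply_coe _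

/-- Continuous linear maps on the completed tensor product are determined by elementary tensors. -/
theorem ext_tmul {Y : Type*} [AddCommGroup Y] [Module 𝕜 Y] [TopologicalSpace Y] [T2Space Y]
    {S T : CompletedTensor 𝕜 E F →L[𝕜] Y} (h : ∀ x y, S (tmul 𝕜 x y) = T (tmul 𝕜 x y)) : S = T := by
  ext z
  induction z using Completion.induction_on with
  | hp => exact isClosed_eq S.continuous T.continuous
  | ih z =>
    induction z using InductiveTensor.induction_on with
    | h0 => rw [Completion.coe_zero, map_zero, map_zero]
    | ht x y => exact h x y
    | ha z z' hz hz' => rw [Completion.coe_add, map_add, map_add, hz, hz']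

/-- The bilinear map `(x, y) ↦ x ⊗ y` into the completed tensor product. -/
def mk : E →ₗ[𝕜] F →ₗ[𝕜] CompletedTensor 𝕜 E F :=
  LinearMap.mk₂ 𝕜 (tmul 𝕜)
    (fun x x' y => by rw [tmul, InductiveTensor.add_tmul, Completion.coe_add]; rfl)
    (fun a x y => by rw [tmul, InductiveTensor.smul_tmul, Completion.coe_smul]; rfl)
    (fun x y y' => by rw [tmul, InductiveTensor.tmul_add, Completion.coe_add]; rfl)
    (fun a x y => by rw [tmul, InductiveTensor.tmul_smul, Completion.coe_smul]; rfl)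

theorem continuous_tmul_left (x : E) : Continuous fun y : F => tmul 𝕜 x y :=
  (Completion.continuous_coe _).comp (InductiveTensor.continuous_tmul_left x)

theorem continuous_tmul_right (y : F) : Continuous fun x : E => tmul 𝕜 x y :=
  (Completion.continuous_coe _).comp (InductiveTensor.continuous_tmul_right y)

end CompletedTensor

section Comparison

variable {𝕜 : Type*} [RCLike 𝕜] {ι : Type*} [LinearOrder ι] [Nonempty ι] {E : ι → Type*}
  [∀ k, AddCommGroup (E k)] [∀ k, Module 𝕜 (E k)] [∀ k, TopologicalSpace (E k)]
  (f : ∀ k l, k ≤ l → E k →L[𝕜] E l) (F : Type*) [AddCommGroup F] [Module 𝕜 F] [TopologicalSpace F]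

omit [Nonempty ι] in
theorem tensorSystem_tmul (k l : ι) (h : k ≤ l) (x : E k) (y : F) :
    tensorSystem f F k l h (CompletedTensor.tmul 𝕜 x y) = CompletedTensor.tmul 𝕜 (f k l h x) y :=
  CompletedTensor.map_tmul _ _ _

/-- The canonical linear map `ind lim (E k ⊗̂ F) → (ind lim E k) ⊗̂ F`. -/
def tensorLimitLinear : LCLimit (tensorSystem f F) →ₗ[𝕜] CompletedTensor 𝕜 (LCLimit f) F :=
  Module.DirectLimit.lift 𝕜 ι _ _
    (fun k => (CompletedTensor.map F (LCLimit.of f k) : CompletedTensor 𝕜 (E k) F →ₗ[𝕜] _))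
    fun k l h z => by
      have : (CompletedTensor.map F (LCLimit.of f l)).comp (tensorSystem f F k l h) =
          CompletedTensor.map F (LCLimit.of f k) := CompletedTensor.ext_tmul fun x y => by
        rw [ContinuousLinearMap.comp_apply, tensorSystem_tmul, CompletedTensor.map_tmul,
          CompletedTensor.map_tmul, LCLimit.of_map]
      exact DFunLike.congr_fun this z

omit [Nonempty ι] in
theorem tensorLimitLinear_of (k : ι) (z : CompletedTensor 𝕜 (E k) F) :
    tensorLimitLinear f F (LCLimit.of (tensorSystem f F) k z) =
      CompletedTensor.map F (LCLimit.of f k) z :=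
  Module.DirectLimit.lift_of (R := 𝕜) (ι := ι) (G := fun k => CompletedTensor 𝕜 (E k) F) _ _ _

/-- The canonical map `ind lim (E k ⊗̂ F) → (ind lim E k) ⊗̂ F`. -/
def tensorLimitMap : LCLimit (tensorSystem f F) →L[𝕜] CompletedTensor 𝕜 (LCLimit f) F where
  toLinearMap := tensorLimitLinear f F
  cont := by
    have : PolynormableSpace 𝕜 (CompletedTensor 𝕜 (LCLimit f) F) := PolynormableSpace.completion
    refine LCLimit.continuous_linearMap (tensorSystem f F) (tensorLimitLinear f F) fun k => ?_
    simp only [tensorLimitLinear_of]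
    exact (CompletedTensor.map F (LCLimit.of f k)).continuous

omit [Nonempty ι] in
theorem tensorLimitMap_tmul (k : ι) (x : E k) (y : F) :
    tensorLimitMap f F (LCLimit.of (tensorSystem f F) k (CompletedTensor.tmul 𝕜 x y)) =
      CompletedTensor.tmul 𝕜 (LCLimit.of f k x) y :=
  (tensorLimitLinear_of f F k _).trans (CompletedTensor.map_tmul _ _ _)

/-- The canonical linear map `(ind lim E k) ⊗ F → ind lim (E k ⊗̂ F)`. -/
def limitTensorLinear : InductiveTensor 𝕜 (LCLimit f) F →ₗ[𝕜] LCLimit (tensorSystem f F) :=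
  TensorProduct.lift (Module.DirectLimit.lift 𝕜 ι _ _
    (fun k => CompletedTensor.mk.compr₂ (LCLimit.of (tensorSystem f F) k : _ →ₗ[𝕜] _))
    fun k l h x => LinearMap.ext fun y => by
      refine Eq.trans ?_ (LCLimit.of_map (tensorSystem f F) k l h (CompletedTensor.tmul 𝕜 x y))
      rw [tensorSystem_tmul]
      rfl)

omit [Nonempty ι] in
theorem limitTensorLinear_tmul (k : ι) (x : E k) (y : F) :
    limitTensorLinear f F (InductiveTensor.tmul 𝕜 (LCLimit.of f k x) y) =
      LCLimit.of (tensorSystem f F) k (CompletedTensor.tmul 𝕜 x y) := by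
  refine (TensorProduct.lift.tmul _ _).trans ?_
  exact DFunLike.congr_fun (Module.DirectLimit.lift_of _ _ _) y

/-- Separate continuity suffices. A fixed x comes from one step; for fixed y the universal property
of ind lim E k reduces the claim to the steps. -/
theorem continuous_limitTensorLinear [∀ k, IsTopologicalAddGroup (E k)] [IsTopologicalAddGroup F] :
    Continuous (limitTensorLinear f F) := by
  refine InductiveTensor.continuous_linearMap _ (fun x => ?_) fun y => ?_
  · obtain ⟨k, x, rfl⟩ := LCLimit.exists_of f x
    simp only [limitTensorLinear_tmul]
    exact (LCLimit.of _ k).continuous.comp (CompletedTensor.continuous_tmul_left x)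
  · refine LCLimit.continuous_linearMap f
      ((limitTensorLinear f F).comp (InductiveTensor.mkRight y)) fun k => ?_
    refine ((LCLimit.of (tensorSystem f F) k).continuous.comp
      (CompletedTensor.continuous_tmul_right y)).congr fun x => ?_
    exact (limitTensorLinear_tmul f F k x y).symm

end Comparison

end

/-! ### The isomorphism -/

theorem proposition4 {𝕜 : Type*} [RCLike 𝕜]
    {ι : Type*} [LinearOrder ι] [Countable ι] [Nonempty ι]
    {E : ι → Type*} [∀ k, AddCommGroup (E k)] [∀ k, Module 𝕜 (E k)] [∀ k, UniformSpace (E k)]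
    (f : ∀ k l, k ≤ l → E k →L[𝕜] E l) (hE : IsLFSystem f)
    {F : Type*} [AddCommGroup F] [Module 𝕜 F] [UniformSpace F] [IsFrechetSpace 𝕜 F]
    (hreg : IsCompactlyRegular (tensorSystem f F)) :
    ∃ Φ : LCLimit (tensorSystem f F) ≃L[𝕜] CompletedTensor 𝕜 (LCLimit f) F,
      ∀ (k : ι) (x : E k) (y : F),
        Φ (LCLimit.of (tensorSystem f F) k (CompletedTensor.tmul 𝕜 x y)) =
          CompletedTensor.tmul 𝕜 (LCLimit.of f k x) y := by
  have hEk := hE.isFrechetSpace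
  have hGk : ∀ k, IsFrechetSpace 𝕜 (CompletedTensor 𝕜 (E k) F) := fun k =>
    IsFrechetSpace.completedTensor 𝕜 (E k) F
  have := fun k => (hEk k).isUniformAddGroup
  have : IsUniformAddGroup F := IsFrechetSpace.isUniformAddGroup 𝕜
  have := fun k => (hGk k).locallyConvex
  have := fun k => (hGk k).metrizable
  have hself : ∀ k z, tensorSystem f F k k le_rfl z = z := fun k z => by
    have : tensorSystem f F k k le_rfl = ContinuousLinearMap.id 𝕜 _ :=
      CompletedTensor.ext_tmul fun x y => by rw [tensorSystem_tmul, hE.map_self]; rfl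
    exact DFunLike.congr_fun this z
  have hmap : ∀ k l m (hkl : k ≤ l) (hlm : l ≤ m) z, tensorSystem f F l m hlm
      (tensorSystem f F k l hkl z) = tensorSystem f F k m (hkl.trans hlm) z := by
    intro k l m hkl hlm z
    have : (tensorSystem f F l m hlm).comp (tensorSystem f F k l hkl) =
        tensorSystem f F k m (hkl.trans hlm) := CompletedTensor.ext_tmul fun x y => by
      rw [ContinuousLinearMap.comp_apply, tensorSystem_tmul, tensorSystem_tmul, tensorSystem_tmul,
        hE.map_map]
    exact DFunLike.congr_fun this z
  have hsmul : ∀ k, ContinuousSMul 𝕜 (CompletedTensor 𝕜 (E k) F) := fun k =>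
    (PolynormableSpace.withSeminorms 𝕜 _).continuousSMul
  have hT2 := LCLimit.t2Space_of_isCompactlyRegular hself hmap hreg
  have hcomplete := LCLimit.completeSpace_of_isCompactlyRegular hself hmap hreg
  let _ : UniformSpace (LCLimit (tensorSystem f F)) := IsTopologicalAddGroup.rightUniformSpace _
  have : IsUniformAddGroup (LCLimit (tensorSystem f F)) := isUniformAddGroup_of_addCommGroup
  have : UniformContinuousConstSMul 𝕜 (LCLimit (tensorSystem f F)) :=
    uniformContinuousConstSMul_of_continuousConstSMul _ _
  let T : InductiveTensor 𝕜 (LCLimit f) F →L[𝕜] LCLimit (tensorSystem f F) :=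
    ⟨limitTensorLinear f F, continuous_limitTensorLinear f F⟩
  -- Extending T to the completion is where `hT2` and `hcomplete` enter.
  have hTtmul : ∀ (k : ι) (x : E k) (y : F), T.fromCompletion
      (CompletedTensor.tmul 𝕜 (LCLimit.of f k x) y) =
        LCLimit.of (tensorSystem f F) k (CompletedTensor.tmul 𝕜 x y) := fun k x y =>
    (T.fromCompletion_apply_coe _).trans (limitTensorLinear_tmul f F k x y)
  refine ⟨ContinuousLinearEquiv.equivOfInverse (tensorLimitMap f F) T.fromCompletion
    (fun z => ?_) (fun z => ?_), tensorLimitMap_tmul f F⟩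
  -- The Hausdorff property of each target lets both inverse identities be checked on elementary
  -- tensors alone.
  · obtain ⟨k, z, rfl⟩ := LCLimit.exists_of _ z
    have : (T.fromCompletion.comp (tensorLimitMap f F)).comp (LCLimit.of (tensorSystem f F) k) =
        LCLimit.of (tensorSystem f F) k := CompletedTensor.ext_tmul fun x y => by
      rw [ContinuousLinearMap.comp_apply, ContinuousLinearMap.comp_apply, tensorLimitMap_tmul, hTtmul]
    exact DFunLike.congr_fun this z
  · have : (tensorLimitMap f F).comp T.fromCompletion = ContinuousLinearMap.id 𝕜 _ :=
      CompletedTensor.ext_tmul fun x y => by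
        obtain ⟨k, x, rfl⟩ := LCLimit.exists_of f x
        rw [ContinuousLinearMap.comp_apply, hTtmul, tensorLimitMap_tmul]
        rfl
    exact DFunLike.congr_fun this z
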